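/- Let $\mathcal M$ be the Euclidean plane $\mathbb E^2=\mathbb C$, the unit sphere $\mathbb S^2\subset\mathbb R^3$, or the hyperbolic plane $\mathbb H^2$ (the Poincaré disk in $\mathbb C$ with Möbius addition $z\oplus w=\frac{z+w}{1+\bar z w}$ and $d(z,w)=2\operatorname{artanh}|(-z)\oplus w|$), with geodesic distance $d$. Let $\mathcal A=[-\alpha_{\max},\alpha_{\max}]$ with $\alpha_{\max}=\frac{\pi}{4}-0.02$. For a closed polygon $\mathbf P=(p_j)_{j\in\mathbb Z/N}$ in $\mathcal M$ let $e_j=d(p_j,p_{j+1})$, $\bar e=\frac1N\sum_j e_j$, $h(\mathbf P)=\max_j e_j$, let $\delta_j\in(-\pi,\pi]$ be the signed exterior angle at $p_j$ (positive for counter-clockwise turns), and put $$\mathbf x_j=\Bigl[\tfrac{\delta_{j-1}}\pi,\tfrac{\delta_j}\pi,\tfrac{\delta_{j+1}}\pi,\tfrac{\delta_{j+2}}\pi,\tfrac{e_j}{\bar e},\tfrac{e_{j+1}}{\bar e},\kappa\Bigr]\in\mathbb R^7,\qquad \kappa=0,+1,-1\ \text{on}\ \mathbb E^2,\mathbb S^2,\mathbb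 H^2;$$ the first four entries form the exterior-angle feature vector $\mathbf x_j^{\angle}$. For $\alpha\in\mathcal A$ let $q_j(\alpha)$ be the apex of the isosceles geodesic triangle over the edge $p_jp_{j+1}$ whose signed base angle at $p_j$ is $\alpha$; thus $d(p_j,q_j(\alpha))$ equals $\frac{e_j}{2\cos\alpha}$ on $\mathbb E^2$, $\arctan\frac{\tan(e_j/2)}{\cos\alpha}$ on $\mathbb S^2$ and $\operatorname{artanh}\frac{\tanh(e_j/2)}{\cos\alpha}$ on $\mathbb H^2$. Angles $\alpha$ are measured counter-clockwise or clockwise; fix either convention. A subdivision step keeps the vertices ($q_{2j}=p_j$) and inserts $q_{2j+1}=q_j(\alpha_j)$. The neural scheme $S_\theta$ of a predictor $f_\theta:\mathbb R^7\to\mathcal A$ uses $\alpha_j=f_\theta(\mathbf x_j)$; the four-point scheme $S_0$ uses $\alpha_j=\frac18(\delta_j+\delta_{j+1})$, clamped to $\mathcal A$. Let $f_\theta:\mathbb R^7\to\mathcal A$ be any function, let $\mathbf P^{(0)}$ be a closed polygon, $\mathbf P^{(k+1)}=S_\theta\mathbf P^{(k)}$ and $h_k=h(\mathbf P^{(k)})$.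 Assume that all $\mathbf P^{(k)}$ are non-degenerate: consecutive vertices are distinct, on $\mathbb S^2$ they are not antipodal, and on $\mathbb H^2$ $\tanh(e_j/2)<\cos\alpha_{\max}$ for all edges (so that all insertions with angles in $\mathcal A$ are defined). Assume further that $h_k\to0$ and that the exterior-angle features are $O(h_k)$: there is $K$ with $\|\mathbf x_j^{\angle}(\mathbf P^{(k)})\|_\infty\le K h_k$ for all $k$ and $j$. Then: 1. $S_\theta$ is $O(h^2)$-proximate to $S_0$ along the subdivision sequence: there is $C'$ with $$d\bigl((S_\theta\mathbf P^{(k)})_j,(S_0\mathbf P^{(k)})_j\bigr)\le C' h_k^2\qquad\text{for all }k,j.$$ Moreover there are $C$ and $\eta>0$ depending only on $\mathcal M$, $K$ and the angle convention (not on $f_\theta$, $N$ or $\mathbf P^{(0)}$) such that the bound holds with $C$ in place of $C'$ for all $k$ with $h_k\le\eta$. 2. The polygons $\mathbf P^{(k)}$ converge uniformly to a closed $C^1$ limit curve in $\mathcal M$ (in particular this is so whenever the iterates of $S_0$ have a $C^1$ limit curve): there are a $1$-periodic $C^1$ map $\gamma:\mathbb R\to\mathcal M$ with nowhere vanishing derivative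 and a continuous strictly increasing $\varphi:\mathbb R\to\mathbb R$ with $\varphi(t+1)=\varphi(t)+1$ such that $\sup_j d\bigl(p^{(k)}_j,\gamma(\varphi(j/(2^kN)))\bigr)\to0$. -/

import Mathlib

open Filter

noncomputable section

namespace AngleSubdivision

/-- The largest admissible insertion angle. -/
def alphaMax : ℝ := Real.pi / 4 - 0.02

/-- The admissible interval of insertion angles. -/
def admissibleAngles : Set ℝ := Set.Icc (-alphaMax) alphaMax

/-- Projection of a real number onto the admissible interval. -/
def clampAngle (a : ℝ) : ℝ := max (-alphaMax) (min alphaMax a)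

/-- The data that an angle-based scheme uses. Only the three instances `euclideanPlane`,
`sphere`, `hyperbolicPlane` below are ever considered. -/
structure Model where
  /-- ambient normed space of the model -/
  V : Type
  [grp : NormedAddCommGroup V]
  [mod : NormedSpace ℝ V]
  /-- the points of the model -/
  carrier : Set V
  /-- geodesic distance -/
  gdist : V → V → ℝ
  /-- `extAngle a p b`: signed exterior angle at `p` of the polygon `a, p, b` -/
  extAngle : V → V → V → ℝ
  /-- `insertPt p q α`: apex of the isosceles geodesic triangle over the edge `p q` whose
  signed base angle at `p` is `α` -/
  insertPt : V → V → ℝ → V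
  /-- the edge `p q` has a direction at both ends, and vertex insertion on it is
  well defined for every admissible angle -/
  goodEdge : V → V → Prop
  /-- geometry code -/
  code : ℝ

attribute [instance] Model.grp Model.mod

/-- `atan2 y x`. -/
def atan2 (y x : ℝ) : ℝ := Complex.arg ⟨x, y⟩

/-! ### The Euclidean plane (identified with `ℂ`) -/

/-- Unit vector from `p` towards `q`. -/
def eDir (p q : ℂ) : ℂ := (q - p) / (‖q - p‖ : ℂ)

/-- Signed angle from the plane vector `v` to the plane vector `w`:
`atan2` of the cross product and the inner product. -/
def planeAngle (v w : ℂ) : ℝ := atan2 (v.re * w.im - v.im * w.re) (v.re * w.re + v.im * w.im)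

/-- Counter-clockwise rotation of the plane by the angle `α`. -/
def rot (α : ℝ) (v : ℂ) : ℂ := Complex.exp (α * Complex.I) * v

/-- The new edge length is `sin |α| / sin (π - 2|α|)` times the old one; this ratio is
written as `1 / (2 cos α)`, its continuous extension to `α = 0`. -/
def euclideanPlane : Model where
  V := ℂ
  carrier := Set.univ
  gdist p q := ‖q - p‖
  extAngle a p b := planeAngle (eDir a p) (eDir p b)
  insertPt p q α := p + ((‖q - p‖ / (2 * Real.cos α) : ℝ) : ℂ) * rot α (eDir p q)
  goodEdge p q := p ≠ q
  code := 0

/-! ### The unit sphere in `ℝ³` -/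

abbrev R3 : Type := EuclideanSpace ℝ (Fin 3)

/-- Cross product of `ℝ³`. -/
def cross (v w : R3) : R3 := WithLp.toLp 2 (crossProduct (WithLp.ofLp v) (WithLp.ofLp w))

/-- Unit tangent at `p` towards `q`. -/
def sDir (p q : R3) : R3 :=
  (‖q - inner ℝ p q • p‖)⁻¹ • (q - inner ℝ p q • p)

/-- Great-circle distance. -/
def sDist (p q : R3) : ℝ := Real.arccos (inner ℝ p q)

/-- Length of the two new edges. -/
def sNew (p q : R3) (α : ℝ) : ℝ := Real.arctan (Real.tan (sDist p q / 2) / Real.cos α)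

def sphere : Model where
  V := R3
  carrier := Metric.sphere 0 1
  gdist := sDist
  extAngle a p b :=
    atan2 (inner ℝ (cross (-sDir p a) (sDir p b)) p) (inner ℝ (-sDir p a) (sDir p b))
  insertPt p q α :=
    Real.cos (sNew p q α) • p +
      Real.sin (sNew p q α) • (Real.cos α • sDir p q + Real.sin α • cross p (sDir p q))
  goodEdge p q := p ≠ q ∧ p ≠ -q
  code := 1

/-! ### The hyperbolic plane (Poincaré disk in `ℂ`) -/

/-- Möbius addition; in complex notation
`((1 + 2⟨z,w⟩ + ‖w‖²) z + (1 - ‖z‖²) w) / (1 + 2⟨z,w⟩ + ‖z‖²‖w‖²) = (z + w) / (1 + z̄ w)`. -/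
def mobiusAdd (z w : ℂ) : ℂ := (z + w) / (1 + (starRingEnd ℂ) z * w)

/-- Hyperbolic distance. -/
def hDist (z w : ℂ) : ℝ := 2 * Real.artanh ‖mobiusAdd (-z) w‖

/-- Unit tangent direction at `z` towards `w`. -/
def hDir (z w : ℂ) : ℂ := mobiusAdd (-z) w / (‖mobiusAdd (-z) w‖ : ℂ)

/-- Length of the two new edges. -/
def hNew (z w : ℂ) (α : ℝ) : ℝ := Real.artanh (Real.tanh (hDist z w / 2) / Real.cos α)

def hyperbolicPlane : Model where
  V := ℂ
  carrier := Metric.ball 0 1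
  gdist := hDist
  extAngle a p b := planeAngle (-hDir p a) (hDir p b)
  insertPt p q α :=
    mobiusAdd p ((Real.tanh (hNew p q α / 2) : ℂ) * rot α (hDir p q))
  goodEdge p q := p ≠ q ∧ Real.tanh (hDist p q / 2) < Real.cos alphaMax
  code := -1

/-- The three geometries. -/
inductive Geometry
  | euclidean
  | spherical
  | hyperbolic

/-- The model space of each geometry. -/
def Geometry.model : Geometry → Model
  | .euclidean => euclideanPlane
  | .spherical => sphere
  | .hyperbolic => hyperbolicPlane

/-! ### Closed polygons

A closed polygon with `N` vertices is a map `P : ℤ → M.V` of period `N`. -/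

section Polygon

variable (M : Model)

/-- `P` is a closed polygon of `M` with `N` vertices. -/
def IsClosedPolygon (N : ℕ) (P : ℤ → M.V) : Prop :=
  0 < N ∧ (∀ j, P (j + N) = P j) ∧ ∀ j, P j ∈ M.carrier

/-- Geodesic length of the edge from `P j` to `P (j+1)`. -/
def edge (P : ℤ → M.V) (j : ℤ) : ℝ := M.gdist (P j) (P (j + 1))

/-- Mean edge length. -/
def meanEdge (N : ℕ) (P : ℤ → M.V) : ℝ := (∑ i ∈ Finset.range N, edge M P i) / N

/-- Mesh width: the largest of the `N` edge lengths. -/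
def meshWidth (N : ℕ) (P : ℤ → M.V) : ℝ := ⨆ i : Fin N, edge M P (i : ℕ)

/-- Signed exterior angle at the vertex `P j`. -/
def delta (P : ℤ → M.V) (j : ℤ) : ℝ := M.extAngle (P (j - 1)) (P j) (P (j + 1))

/-- The seven-dimensional feature vector of the edge `j`. -/
def feature (N : ℕ) (P : ℤ → M.V) (j : ℤ) : Fin 7 → ℝ :=
  ![delta M P (j - 1) / Real.pi, delta M P j / Real.pi,
    delta M P (j + 1) / Real.pi, delta M P (j + 2) / Real.pi,
    edge M P j / meanEdge M N P, edge M P (j + 1) / meanEdge M N P, M.code]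

/-- The exterior-angle features of the edge `j`: the first four entries of `feature`. -/
def angleFeature (N : ℕ) (P : ℤ → M.V) (j : ℤ) : Fin 4 → ℝ :=
  fun i => feature M N P j (Fin.castLE (by norm_num) i)

/-- One subdivision step with insertion angle `a j` on the edge `j`: old vertices are kept,
`q (2j) = p j`, and `q (2j+1)` is inserted on the edge `j`. The sign `s = ±1` is the sense
in which insertion angles are measured: counter-clockwise for `1`, clockwise for `-1`. -/
def subdivide (s : ℝ) (a : ℤ → ℝ) (P : ℤ → M.V) : ℤ → M.V := fun i =>
  if i % 2 = 0 then P (i / 2) else M.insertPt (P (i / 2)) (P (i / 2 + 1)) (s * a (i / 2))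

/-- The scheme `S_θ` of the predictor `f`, applied to a polygon with `N` vertices. -/
def neuralStep (s : ℝ) (f : (Fin 7 → ℝ) → ℝ) (N : ℕ) (P : ℤ → M.V) : ℤ → M.V :=
  subdivide M s (fun j => f (feature M N P j)) P

/-- Insertion angle of the classical rule with tension `μ`. -/
def classicalAngle (μ : ℝ) (P : ℤ → M.V) (j : ℤ) : ℝ :=
  clampAngle
    ((μ * (delta M P (j - 1) + delta M P (j + 2)) + (1 - μ) * (delta M P j + delta M P (j + 1))) / 8)

/-- The four-point scheme `S_0`: the classical rule with `μ = 0`. -/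
def fourPointStep (s : ℝ) (P : ℤ → M.V) : ℤ → M.V :=
  subdivide M s (classicalAngle M 0 P) P

/-- The polygon with `N * 2 ^ k` vertices after `k` steps of `S_θ`. -/
def neuralIter (s : ℝ) (f : (Fin 7 → ℝ) → ℝ) (N : ℕ) (P : ℤ → M.V) : ℕ → ℤ → M.V
  | 0 => P
  | k + 1 => neuralStep M s f (N * 2 ^ k) (neuralIter s f N P k)

/-- Mesh widths tend to zero, and the exterior-angle features are at most `K` times the mesh
width along the sequence `P 0, P 1, …`, where `P k` has `N * 2 ^ k` vertices. -/
def AngleDecay (K : ℝ) (N : ℕ) (P : ℕ → ℤ → M.V) : Prop :=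
  Tendsto (fun k => meshWidth M (N * 2 ^ k) (P k)) atTop (nhds 0) ∧
    ∀ k j, ‖angleFeature M (N * 2 ^ k) (P k) j‖ ≤ K * meshWidth M (N * 2 ^ k) (P k)

/-- The polygons `P k` (with `N * 2 ^ k` vertices) converge uniformly to a closed regular `C¹`
curve of `M`: `γ` is a `1`-periodic `C¹` parametrization with nowhere vanishing derivative, and
`φ` relates the dyadic parameters of the vertices to the parameter of `γ`. -/
def HasC1LimitCurve (N : ℕ) (P : ℕ → ℤ → M.V) : Prop :=
  ∃ (γ : ℝ → M.V) (φ : ℝ → ℝ),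
    ContDiff ℝ 1 γ ∧ (∀ t, deriv γ t ≠ 0) ∧ (∀ t, γ (t + 1) = γ t) ∧ (∀ t, γ t ∈ M.carrier) ∧
    Continuous φ ∧ StrictMono φ ∧ (∀ t, φ (t + 1) = φ t + 1) ∧
    ∀ ε > 0, ∀ᶠ k in atTop, ∀ j : ℤ,
      M.gdist (P k j) (γ (φ ((j : ℝ) / (N * 2 ^ k)))) < ε

end Polygon

end AngleSubdivision

end

noncomputable section

namespace AngleSubdivision

open Topology ComplexConjugate

/-! ### Discrete primitives on `ℤ` -/

/-- The signed sum of `e` from `0` to `j`. -/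
def primitive (e : ℤ → ℝ) (j : ℤ) : ℝ :=
  ∑ i ∈ Finset.range j.toNat, e i - ∑ i ∈ Finset.range (-j).toNat, e (-(i + 1))

theorem primitive_zero (e : ℤ → ℝ) : primitive e 0 = 0 := by simp [primitive]

theorem primitive_succ (e : ℤ → ℝ) (j : ℤ) : primitive e (j + 1) = primitive e j + e j := by
  rcases le_or_gt 0 j with h | h
  · lift j to ℕ using h
    have h1 : ((j : ℤ) + 1).toNat = j + 1 := by omega
    have h2 : (-((j : ℤ) + 1)).toNat = 0 := by omega
    have h3 : (-(j : ℤ)).toNat = 0 := by omega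
    simp only [primitive, h1, h2, h3, Finset.sum_range_succ, Finset.range_zero,
      Finset.sum_empty, Int.toNat_natCast]
    ring
  · obtain ⟨n, rfl⟩ : ∃ n : ℕ, j = -((n : ℤ) + 1) := ⟨(-j - 1).toNat, by omega⟩
    have h1 : (-((n : ℤ) + 1) + 1).toNat = 0 := by omega
    have h2 : (-(-((n : ℤ) + 1) + 1)).toNat = n := by omega
    have h3 : (-((n : ℤ) + 1)).toNat = 0 := by omega
    have h4 : (- -((n : ℤ) + 1)).toNat = n + 1 := by omega
    simp only [primitive, h1, h2, h3, h4, Finset.sum_range_succ, Finset.range_zero,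
      Finset.sum_empty]
    ring

theorem norm_sub_le_of_norm_succ_sub_le {E : Type*} [SeminormedAddCommGroup E] {f : ℤ → E} {b : ℝ}
    (hf : ∀ j, ‖f (j + 1) - f j‖ ≤ b) (i j : ℤ) : ‖f i - f j‖ ≤ b * |(i : ℝ) - j| := by
  have key : ∀ (j : ℤ) (n : ℕ), ‖f (j + n) - f j‖ ≤ b * n := by
    intro j n
    induction n with
    | zero => simp
    | succ n ih =>
      have h := hf (j + n)
      have e : f (j + (n + 1 : ℕ)) - f j = (f (j + n + 1) - f (j + n)) + (f (j + n) - f j) := by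
        push_cast
        rw [← add_assoc]
        abel
      rw [e]
      push_cast
      linarith [norm_add_le (f (j + n + 1) - f (j + n)) (f (j + n) - f j)]
  rcases le_total j i with h | h
  · obtain ⟨n, rfl⟩ := Int.le.dest h
    have := key j n
    simpa using this
  · obtain ⟨n, rfl⟩ := Int.le.dest h
    have := key i n
    rw [norm_sub_rev]
    simpa using this

section Direction

variable {V : Type*} [NormedAddCommGroup V] [NormedSpace ℝ V]

/-- Normalized chord from `p` to `q`. -/
def chordDir (p q : V) : V := ‖q - p‖⁻¹ • (q - p)

theorem norm_chordDir {p q : V} (h : p ≠ q) : ‖chordDir p q‖ = 1 := by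
  have : ‖q - p‖ ≠ 0 := by rw [norm_ne_zero_iff, sub_ne_zero]; exact h.symm
  rw [chordDir, norm_smul, norm_inv, norm_norm, inv_mul_cancel₀ this]

theorem norm_smul_chordDir (p q : V) : ‖q - p‖ • chordDir p q = q - p := by
  rcases eq_or_ne p q with rfl | h
  · simp [chordDir]
  · have : ‖q - p‖ ≠ 0 := by rw [norm_ne_zero_iff, sub_ne_zero]; exact h.symm
    rw [chordDir, smul_inv_smul₀ this]

theorem chordDir_comm (p q : V) : chordDir q p = -chordDir p q := by
  rw [chordDir, chordDir, norm_sub_rev, ← smul_neg, neg_sub]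

/-- Two normalized vectors are close if the vectors are close relative to their size. -/
theorem norm_inv_smul_sub_le {v w : V} (hv : v ≠ 0) :
    ‖‖v‖⁻¹ • v - ‖w‖⁻¹ • w‖ ≤ 2 * ‖v - w‖ / ‖v‖ := by
  have hv' : 0 < ‖v‖ := norm_pos_iff.2 hv
  rcases eq_or_ne w 0 with rfl | hw
  · simp only [smul_zero, sub_zero, norm_smul, norm_inv, norm_norm]
    rw [inv_mul_cancel₀ hv'.ne', mul_div_assoc, div_self hv'.ne']
    norm_num
  have hw' : 0 < ‖w‖ := norm_pos_iff.2 hw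
  have e : ‖v‖⁻¹ • v - ‖w‖⁻¹ • w = ‖v‖⁻¹ • ((v - w) + (1 - ‖v‖ * ‖w‖⁻¹) • w) := by
    rw [smul_add, smul_smul, smul_sub, mul_sub, ← mul_assoc, inv_mul_cancel₀ hv'.ne', sub_smul]
    simp
  have h2 : ‖(1 - ‖v‖ * ‖w‖⁻¹) • w‖ = |‖w‖ - ‖v‖| := by
    rw [norm_smul, Real.norm_eq_abs, ← abs_of_pos hw', ← abs_mul, abs_of_pos hw']
    congr 1
    field_simp
  rw [e, norm_smul, norm_inv, norm_norm, inv_mul_eq_div]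
  gcongr
  have := norm_add_le (v - w) ((1 - ‖v‖ * ‖w‖⁻¹) • w)
  have h3 := abs_norm_sub_norm_le w v
  rw [norm_sub_rev] at h3
  linarith

theorem norm_straightened_sub (a b c : V) :
    ‖(‖b - a‖ + ‖c - b‖) • chordDir a b - (c - a)‖ =
      ‖c - b‖ * ‖chordDir b c - chordDir a b‖ := by
  have h : (‖b - a‖ + ‖c - b‖) • chordDir a b - (c - a) =
      ‖c - b‖ • (chordDir a b - chordDir b c) := by
    rw [add_smul, norm_smul_chordDir, smul_sub, norm_smul_chordDir]
    abel
  rw [h, norm_smul, norm_norm, norm_sub_rev (chordDir a b)]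

theorem norm_chordDir_sub_chordDir_le {a b c : V} (hab : a ≠ b) :
    ‖chordDir a b - chordDir a c‖ ≤ 2 * ‖chordDir b c - chordDir a b‖ := by
  have h1 : 0 < ‖b - a‖ := norm_pos_iff.2 (sub_ne_zero.2 hab.symm)
  have h2 := norm_nonneg (c - b)
  have h3 : 0 < ‖b - a‖ + ‖c - b‖ := by linarith
  have hT := norm_chordDir hab
  have hn : ‖(‖b - a‖ + ‖c - b‖) • chordDir a b‖ = ‖b - a‖ + ‖c - b‖ := by
    rw [norm_smul, hT, mul_one, Real.norm_of_nonneg h3.le]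
  have key := norm_inv_smul_sub_le (v := (‖b - a‖ + ‖c - b‖) • chordDir a b) (w := c - a)
    (by rw [← norm_pos_iff, hn]; exact h3)
  rw [hn, inv_smul_smul₀ h3.ne', norm_straightened_sub] at key
  refine key.trans ?_
  rw [div_le_iff₀ h3]
  nlinarith [norm_nonneg (chordDir b c - chordDir a b)]

/-- Splitting a chord increases the length by at most the turning. -/
theorem norm_add_norm_le {a b c : V} (hab : a ≠ b) :
    ‖b - a‖ + ‖c - b‖ ≤ ‖c - a‖ + ‖c - b‖ * ‖chordDir b c - chordDir a b‖ := by
  have h1 := norm_nonneg (b - a)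
  have h2 := norm_nonneg (c - b)
  have hn : ‖(‖b - a‖ + ‖c - b‖) • chordDir a b‖ = ‖b - a‖ + ‖c - b‖ := by
    rw [norm_smul, norm_chordDir hab, mul_one, Real.norm_of_nonneg (by linarith)]
  rw [← norm_straightened_sub, ← hn]
  have := norm_sub_norm_le ((‖b - a‖ + ‖c - b‖) • chordDir a b) (c - a)
  rw [hn] at this ⊢
  linarith

end Direction

/-! ### The limit curve of a refining sequence of polygons -/

/-- Closed polygons `P k` with `N * 2 ^ k` vertices, each refining the previous one by vertex
insertion, whose chords and turnings decay like `2 ^ (-k)`. -/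
structure IsRefining {V : Type*} [NormedAddCommGroup V] [NormedSpace ℝ V] (N : ℕ)
    (P : ℕ → ℤ → V) (A : ℝ) : Prop where
  pos : 0 < N
  periodic : ∀ k j, P k (j + (N * 2 ^ k : ℕ)) = P k j
  even : ∀ k j, P (k + 1) (2 * j) = P k j
  ne : ∀ k j, P k j ≠ P k (j + 1)
  chord_le : ∀ k j, ‖P k (j + 1) - P k j‖ ≤ A * (1 / 2) ^ k
  turn_le : ∀ k j, ‖chordDir (P k (j + 1)) (P k (j + 1 + 1)) - chordDir (P k j) (P k (j + 1))‖ ≤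
    A * (1 / 2) ^ k

/-- Index of the last vertex of the `k`-th polygon whose dyadic parameter is at most `t`. -/
def dyadicIdx (N k : ℕ) (t : ℝ) : ℤ := ⌊t * (N * 2 ^ k)⌋

theorem dyadicIdx_succ (N k : ℕ) (t : ℝ) :
    dyadicIdx N (k + 1) t = 2 * dyadicIdx N k t ∨
      dyadicIdx N (k + 1) t = 2 * dyadicIdx N k t + 1 := by
  have h1 := Int.floor_le (t * (N * 2 ^ k))
  have h2 := Int.lt_floor_add_one (t * (N * 2 ^ k))
  have e : t * (N * 2 ^ (k + 1)) = 2 * (t * (N * 2 ^ k)) := by ring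
  have h3 : 2 * ⌊t * (N * 2 ^ k)⌋ ≤ ⌊t * (N * 2 ^ (k + 1))⌋ := by
    rw [Int.le_floor, e]; push_cast; linarith
  have h4 : ⌊t * (N * 2 ^ (k + 1))⌋ < 2 * ⌊t * (N * 2 ^ k)⌋ + 2 := by
    rw [Int.floor_lt, e]; push_cast; linarith
  unfold dyadicIdx
  omega

theorem dyadicIdx_mono {N k : ℕ} {t u : ℝ} (h : t ≤ u) : dyadicIdx N k t ≤ dyadicIdx N k u :=
  Int.floor_le_floor (by gcongr)

theorem dyadicIdx_add_one (N k : ℕ) (t : ℝ) :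
    dyadicIdx N k (t + 1) = dyadicIdx N k t + (N * 2 ^ k : ℕ) := by
  unfold dyadicIdx
  rw [← Int.floor_add_natCast]
  congr 1
  push_cast
  ring

theorem dyadicIdx_dyadic {N : ℕ} (hN : 0 < N) (k m : ℕ) (j : ℤ) :
    dyadicIdx N (k + m) ((j : ℝ) / (N * 2 ^ k)) = 2 ^ m * j := by
  have h : (j : ℝ) / (N * 2 ^ k) * (N * 2 ^ (k + m)) = ((2 ^ m * j : ℤ) : ℝ) := by
    have : (N : ℝ) ≠ 0 := by positivity
    push_cast
    field_simp
    ring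
  rw [dyadicIdx, h, Int.floor_intCast]

theorem abs_dyadicIdx_sub_le (N k : ℕ) (t u : ℝ) :
    |(dyadicIdx N k t : ℝ) - dyadicIdx N k u| ≤ N * 2 ^ k * |t - u| + 1 := by
  have h1 := Int.floor_le (t * (N * 2 ^ k))
  have h2 := Int.lt_floor_add_one (t * (N * 2 ^ k))
  have h3 := Int.floor_le (u * (N * 2 ^ k))
  have h4 := Int.lt_floor_add_one (u * (N * 2 ^ k))
  have h5 : |t * (N * 2 ^ k) - u * (N * 2 ^ k)| = N * 2 ^ k * |t - u| := by
    rw [← sub_mul, abs_mul, abs_of_nonneg (by positivity : (0 : ℝ) ≤ N * 2 ^ k)]; ring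
  rw [← h5]
  have h6 := le_abs_self (t * (N * 2 ^ k) - u * (N * 2 ^ k))
  have h7 := neg_abs_le (t * (N * 2 ^ k) - u * (N * 2 ^ k))
  unfold dyadicIdx
  rw [abs_le]
  constructor <;> linarith

namespace IsRefining

variable {V : Type*} [NormedAddCommGroup V]

/-- Length of the `k`-th polygon from the vertex `0` to the vertex `j`. -/
def cumLength (P : ℕ → ℤ → V) (k : ℕ) : ℤ → ℝ := primitive fun i => ‖P k (i + 1) - P k i‖

theorem cumLength_succ (P : ℕ → ℤ → V) (k : ℕ) (j : ℤ) :
    cumLength P k (j + 1) = cumLength P k j + ‖P k (j + 1) - P k j‖ := primitive_succ _ _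

theorem norm_sub_le_cumLength (P : ℕ → ℤ → V) (k : ℕ) {i j : ℤ} (h : i ≤ j) :
    ‖P k j - P k i‖ ≤ cumLength P k j - cumLength P k i := by
  induction j, h using Int.leInduction with
  | base => simp
  | succ j _ ih =>
    rw [cumLength_succ]
    linarith [norm_sub_le_norm_sub_add_norm_sub (P k (j + 1)) (P k j) (P k i)]

variable [NormedSpace ℝ V]

/-- Direction of the edge `j` of the `k`-th polygon. -/
def dir (P : ℕ → ℤ → V) (k : ℕ) (j : ℤ) : V := chordDir (P k j) (P k (j + 1))

variable {N : ℕ} {P : ℕ → ℤ → V} {A : ℝ}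

theorem nonneg (h : IsRefining N P A) : 0 ≤ A := by
  simpa using (norm_nonneg _).trans (h.chord_le 0 0)

theorem norm_dir (h : IsRefining N P A) (k : ℕ) (j : ℤ) : ‖dir P k j‖ = 1 :=
  norm_chordDir (h.ne k j)

theorem apply_pow_mul (h : IsRefining N P A) (k m : ℕ) (j : ℤ) : P (k + m) (2 ^ m * j) = P k j := by
  induction m with
  | zero => simp
  | succ m ih => rw [← add_assoc, pow_succ', mul_assoc, h.even, ih]

theorem even_add_two (h : IsRefining N P A) (k : ℕ) (j : ℤ) :
    P (k + 1) (2 * j + 1 + 1) = P k (j + 1) := by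
  rw [← h.even k (j + 1)]; ring_nf

theorem norm_dir_sub_le (h : IsRefining N P A) (k : ℕ) (i j : ℤ) :
    ‖dir P k i - dir P k j‖ ≤ A * (1 / 2) ^ k * |(i : ℝ) - j| :=
  norm_sub_le_of_norm_succ_sub_le (f := dir P k) (h.turn_le k) i j

theorem abs_cumLength_sub_le (h : IsRefining N P A) (k : ℕ) (i j : ℤ) :
    |cumLength P k i - cumLength P k j| ≤ A * (1 / 2) ^ k * |(i : ℝ) - j| := by
  refine norm_sub_le_of_norm_succ_sub_le (f := cumLength P k) (fun j => ?_) i j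
  rw [cumLength_succ, add_sub_cancel_left, norm_norm]
  exact h.chord_le k j

theorem norm_dir_even_sub_le (h : IsRefining N P A) (k : ℕ) (j : ℤ) :
    ‖dir P (k + 1) (2 * j) - dir P k j‖ ≤ A * (1 / 2) ^ k := by
  have h1 := norm_chordDir_sub_chordDir_le (h.ne (k + 1) (2 * j)) (c := P (k + 1) (2 * j + 1 + 1))
  have h2 := h.turn_le (k + 1) (2 * j)
  rw [dir, dir, ← h.even_add_two k j, ← h.even k j]
  refine h1.trans ?_
  rw [pow_succ] at h2
  linarith

theorem dist_vertex_le (h : IsRefining N P A) (k : ℕ) (t : ℝ) :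
    dist (P k (dyadicIdx N k t)) (P (k + 1) (dyadicIdx N (k + 1) t)) ≤ A * (1 / 2) ^ k := by
  have hA := h.nonneg
  rcases dyadicIdx_succ N k t with e | e
  · rw [e, h.even, dist_self]; positivity
  · rw [e, dist_comm, dist_eq_norm, ← h.even k]
    refine (h.chord_le _ _).trans ?_
    rw [pow_succ]
    nlinarith [mul_nonneg hA (by positivity : (0 : ℝ) ≤ (1 / 2) ^ k)]

theorem dist_dir_le (h : IsRefining N P A) (k : ℕ) (t : ℝ) :
    dist (dir P k (dyadicIdx N k t)) (dir P (k + 1) (dyadicIdx N (k + 1) t)) ≤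
      2 * A * (1 / 2) ^ k := by
  have hA := h.nonneg
  have h1 := h.norm_dir_even_sub_le k (dyadicIdx N k t)
  have h0 : 0 ≤ A * (1 / 2) ^ k := by positivity
  rcases dyadicIdx_succ N k t with e | e
  · rw [e, dist_comm, dist_eq_norm]; linarith
  · rw [e, dist_comm, dist_eq_norm]
    have h2 := h.turn_le (k + 1) (2 * dyadicIdx N k t)
    change ‖dir P (k + 1) (2 * dyadicIdx N k t + 1) - dir P (k + 1) (2 * dyadicIdx N k t)‖ ≤ _ at h2
    rw [pow_succ] at h2
    linarith [norm_sub_le_norm_sub_add_norm_sub (dir P (k + 1) (2 * dyadicIdx N k t + 1))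
      (dir P (k + 1) (2 * dyadicIdx N k t)) (dir P k (dyadicIdx N k t))]

theorem abs_cumLength_even_sub_le (h : IsRefining N P A) (k : ℕ) (j : ℤ) :
    |cumLength P (k + 1) (2 * j) - cumLength P k j| ≤ A ^ 2 * (1 / 4) ^ k * |(j : ℝ)| := by
  have key := norm_sub_le_of_norm_succ_sub_le
    (f := fun j => cumLength P (k + 1) (2 * j) - cumLength P k j) (b := A ^ 2 * (1 / 4) ^ k)
    (fun j => ?_) j 0
  · simpa [cumLength, primitive_zero] using key
  · have e : 2 * (j + 1) = 2 * j + 1 + 1 := by ring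
    have h1 := h.chord_le (k + 1) (2 * j + 1)
    have h2 := h.turn_le (k + 1) (2 * j)
    have h3 := norm_add_norm_le (h.ne (k + 1) (2 * j)) (c := P (k + 1) (2 * j + 1 + 1))
    have h4 := norm_sub_le_norm_sub_add_norm_sub (P (k + 1) (2 * j + 1 + 1)) (P (k + 1) (2 * j + 1))
      (P (k + 1) (2 * j))
    have h5 := mul_le_mul h1 h2 (norm_nonneg _) ((norm_nonneg _).trans h1)
    have h6 : A * (1 / 2) ^ (k + 1) * (A * (1 / 2) ^ (k + 1)) = A ^ 2 * (1 / 4) ^ k / 4 := by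
      rw [show (1 / 4 : ℝ) = (1 / 2) * (1 / 2) by norm_num, mul_pow]; ring
    have h7 : 0 ≤ A ^ 2 * (1 / 4 : ℝ) ^ k := by positivity
    rw [h6] at h5
    simp only [e, cumLength_succ, ← h.even_add_two k j]
    rw [← h.even k j, Real.norm_eq_abs, abs_le]
    constructor <;> linarith

theorem dist_cumLength_le (h : IsRefining N P A) (k : ℕ) (t : ℝ) :
    dist (cumLength P k (dyadicIdx N k t)) (cumLength P (k + 1) (dyadicIdx N (k + 1) t)) ≤
      (A ^ 2 * (N * |t| + 1) + A) * (1 / 2) ^ k := by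
  have hA := h.nonneg
  have h1 := h.abs_cumLength_even_sub_le k (dyadicIdx N k t)
  have h2 : |(dyadicIdx N k t : ℝ)| ≤ N * 2 ^ k * |t| + 1 := by
    simpa [dyadicIdx] using abs_dyadicIdx_sub_le N k t 0
  have h3 : A ^ 2 * (1 / 4) ^ k * |(dyadicIdx N k t : ℝ)| ≤
      A ^ 2 * (N * |t| + 1) * (1 / 2) ^ k := by
    have e : (1 / 4 : ℝ) ^ k = (1 / 2) ^ k * (1 / 2) ^ k := by rw [← mul_pow]; norm_num
    have e2 : (1 / 2 : ℝ) ^ k * 2 ^ k = 1 := by rw [← mul_pow]; norm_num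
    have e3 : (1 / 2 : ℝ) ^ k ≤ 1 := pow_le_one₀ (by norm_num) (by norm_num)
    have e4 : (1 / 2 : ℝ) ^ k * |(dyadicIdx N k t : ℝ)| ≤ N * |t| + 1 := by
      calc _ ≤ (1 / 2 : ℝ) ^ k * (N * 2 ^ k * |t| + 1) := by gcongr
        _ = N * |t| * ((1 / 2 : ℝ) ^ k * 2 ^ k) + (1 / 2 : ℝ) ^ k := by ring
        _ ≤ _ := by rw [e2]; linarith
    calc _ = A ^ 2 * ((1 / 2 : ℝ) ^ k * |(dyadicIdx N k t : ℝ)|) * (1 / 2) ^ k := by rw [e]; ring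
      _ ≤ _ := by gcongr
  have h0 : 0 ≤ A * (1 / 2) ^ k := by positivity
  have h4 := h.chord_le (k + 1) (2 * dyadicIdx N k t)
  rw [pow_succ] at h4
  rw [dist_comm, Real.dist_eq]
  rw [abs_le] at h1
  rcases dyadicIdx_succ N k t with e | e
  · rw [e, abs_le]; constructor <;> linarith
  · rw [e, cumLength_succ, abs_le]
    constructor <;> linarith [norm_nonneg (P (k + 1) (2 * dyadicIdx N k t + 1) - P (k + 1) (2 * dyadicIdx N k t))]

theorem norm_sub_sub_cumLength_smul_dir_le (h : IsRefining N P A) (k : ℕ) {i j : ℤ} (hij : i ≤ j) :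
    ‖P k j - P k i - (cumLength P k j - cumLength P k i) • dir P k i‖ ≤
      (cumLength P k j - cumLength P k i) * (A * (1 / 2) ^ k * (j - i)) := by
  have hA := h.nonneg
  induction j, hij using Int.leInduction with
  | base => simp
  | succ j hj ih =>
    have hj' : (i : ℝ) ≤ j := by exact_mod_cast hj
    have h1 := h.norm_dir_sub_le k j i
    rw [abs_of_nonneg (by linarith)] at h1
    have h2 : 0 ≤ cumLength P k j - cumLength P k i :=
      (norm_nonneg _).trans (norm_sub_le_cumLength P k hj)
    have e : P k (j + 1) - P k i - (cumLength P k (j + 1) - cumLength P k i) • dir P k i =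
        (P k j - P k i - (cumLength P k j - cumLength P k i) • dir P k i) +
          ‖P k (j + 1) - P k j‖ • (dir P k j - dir P k i) := by
      rw [cumLength_succ, smul_sub, dir, dir, norm_smul_chordDir, add_sub_right_comm, add_smul]
      abel
    have h3 := norm_add_le (P k j - P k i - (cumLength P k j - cumLength P k i) • dir P k i)
      (‖P k (j + 1) - P k j‖ • (dir P k j - dir P k i))
    have h4 := mul_le_mul_of_nonneg_left h1 (norm_nonneg (P k (j + 1) - P k j))
    rw [norm_smul, norm_norm] at h3
    rw [e, cumLength_succ]
    push_cast
    have h5 : 0 ≤ (cumLength P k j - cumLength P k i + ‖P k (j + 1) - P k j‖) *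
      (A * (1 / 2) ^ k) := by positivity
    nlinarith

theorem cumLength_add_period (h : IsRefining N P A) (k : ℕ) (j : ℤ) :
    cumLength P k (j + (N * 2 ^ k : ℕ)) - cumLength P k j = cumLength P k (N * 2 ^ k : ℕ) := by
  have key := norm_sub_le_of_norm_succ_sub_le
    (f := fun j => cumLength P k (j + (N * 2 ^ k : ℕ)) - cumLength P k j) (b := 0) (fun j => ?_) j 0
  · rw [zero_mul, norm_le_zero_iff, sub_eq_zero] at key
    simpa [cumLength, primitive_zero] using key
  · have e : j + 1 + ((N * 2 ^ k : ℕ) : ℤ) = j + ((N * 2 ^ k : ℕ) : ℤ) + 1 := by ring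
    have e2 := h.periodic k (j + 1)
    rw [e] at e2
    rw [e, cumLength_succ, cumLength_succ, h.periodic, e2]
    simp

end IsRefining

namespace IsRefining

variable {V : Type*} [NormedAddCommGroup V] [NormedSpace ℝ V] [CompleteSpace V]
  {N : ℕ} {P : ℕ → ℤ → V} {A : ℝ}

theorem exists_limits (h : IsRefining N P A) (t : ℝ) : ∃ (x T : V) (l : ℝ),
    Tendsto (fun k => P k (dyadicIdx N k t)) atTop (𝓝 x) ∧
    Tendsto (fun k => dir P k (dyadicIdx N k t)) atTop (𝓝 T) ∧
    Tendsto (fun k => cumLength P k (dyadicIdx N k t)) atTop (𝓝 l) := by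
  obtain ⟨x, hx⟩ := cauchySeq_tendsto_of_complete
    (cauchySeq_of_le_geometric (1 / 2) A (by norm_num) fun k => h.dist_vertex_le k t)
  obtain ⟨T, hT⟩ := cauchySeq_tendsto_of_complete
    (cauchySeq_of_le_geometric (1 / 2) (2 * A) (by norm_num) fun k => h.dist_dir_le k t)
  obtain ⟨l, hl⟩ := cauchySeq_tendsto_of_complete
    (cauchySeq_of_le_geometric (1 / 2) _ (by norm_num) fun k => h.dist_cumLength_le k t)
  exact ⟨x, T, l, hx, hT, hl⟩

theorem tendsto_index_bound (N : ℕ) (A : ℝ) (t u : ℝ) :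
    Tendsto (fun k : ℕ => A * (1 / 2) ^ k * (N * 2 ^ k * |t - u| + 1)) atTop
      (𝓝 (A * N * |t - u|)) := by
  have h1 : Tendsto (fun k : ℕ => A * N * |t - u| + A * (1 / 2 : ℝ) ^ k) atTop
      (𝓝 (A * N * |t - u| + A * 0)) :=
    tendsto_const_nhds.add ((tendsto_pow_atTop_nhds_zero_of_lt_one (by norm_num)
      (by norm_num)).const_mul A)
  rw [mul_zero, add_zero] at h1
  refine h1.congr fun k => ?_
  have e2 : (1 / 2 : ℝ) ^ k * 2 ^ k = 1 := by rw [← mul_pow]; norm_num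
  linear_combination -A * N * |t - u| * e2

theorem exists_dyadic_between {N : ℕ} (hN : 0 < N) {t u : ℝ} (h : t < u) :
    ∃ (k : ℕ) (j : ℤ), t ≤ (j : ℝ) / (N * 2 ^ k) ∧ ((j + 1 : ℤ) : ℝ) / (N * 2 ^ k) ≤ u := by
  obtain ⟨k, hk⟩ := pow_unbounded_of_one_lt (2 / (u - t)) (by norm_num : (1 : ℝ) < 2)
  have hN' : (1 : ℝ) ≤ N := by exact_mod_cast hN
  have h0 : 0 < u - t := by linarith
  rw [div_lt_iff₀ h0] at hk
  have hp : (0 : ℝ) < N * 2 ^ k := by positivity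
  have hk' : 2 < N * 2 ^ k * (u - t) := by
    have : 2 ^ k * (u - t) ≤ N * (2 ^ k * (u - t)) := le_mul_of_one_le_left (by positivity) hN'
    linarith
  refine ⟨k, ⌈t * (N * 2 ^ k)⌉, ?_, ?_⟩
  · rw [le_div_iff₀ hp]; exact Int.le_ceil _
  · rw [div_le_iff₀ hp]
    have := Int.ceil_lt_add_one (t * (N * 2 ^ k))
    push_cast
    linarith

/-- The limit of a refining sequence, parametrized by dyadic parameters, with its directions and
its arc length. -/
theorem exists_limit_functions (h : IsRefining N P A) : ∃ (F T : ℝ → V) (Φ : ℝ → ℝ),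
    (∀ (k : ℕ) (j : ℤ), F ((j : ℝ) / (N * 2 ^ k)) = P k j) ∧
    (∀ t, F (t + 1) = F t) ∧ (∀ t, F t ∈ closure {x | ∃ k j, P k j = x}) ∧
    (∀ t, ‖T t‖ = 1) ∧ Continuous T ∧ Continuous Φ ∧ StrictMono Φ ∧
    (∀ t, Φ (t + 1) = Φ t + (Φ 1 - Φ 0)) ∧
    (∀ t u, ‖F u - F t - (Φ u - Φ t) • T t‖ ≤ 2 * (A * N) * |u - t| * |Φ u - Φ t|) := by
  choose F T Φ hF hT hΦ using h.exists_limits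
  have hFd : ∀ (k : ℕ) (j : ℤ), F ((j : ℝ) / (N * 2 ^ k)) = P k j := by
    intro k j
    refine tendsto_nhds_unique (hF _) (tendsto_atTop_of_eventually_const (i₀ := k) fun m hm => ?_)
    obtain ⟨m, rfl⟩ := Nat.exists_eq_add_of_le hm
    rw [dyadicIdx_dyadic h.pos, h.apply_pow_mul]
  have hTlip : ∀ t u, ‖T t - T u‖ ≤ A * N * |t - u| := by
    intro t u
    refine le_of_tendsto_of_tendsto' ((hT t).sub (hT u)).norm (tendsto_index_bound N A t u)
      fun k => (h.norm_dir_sub_le k _ _).trans ?_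
    have := h.nonneg
    gcongr
    exact abs_dyadicIdx_sub_le N k t u
  have hΦlip : ∀ t u, ‖Φ t - Φ u‖ ≤ A * N * |t - u| := by
    intro t u
    refine le_of_tendsto_of_tendsto' ((hΦ t).sub (hΦ u)).norm (tendsto_index_bound N A t u)
      fun k => (h.abs_cumLength_sub_le k _ _).trans ?_
    have := h.nonneg
    gcongr
    exact abs_dyadicIdx_sub_le N k t u
  have hFΦ : ∀ t u, t ≤ u → ‖F u - F t‖ ≤ Φ u - Φ t := fun t u htu =>
    le_of_tendsto_of_tendsto' ((hF u).sub (hF t)).norm ((hΦ u).sub (hΦ t))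
      fun k => norm_sub_le_cumLength P k (dyadicIdx_mono htu)
  have hmono : Monotone Φ := fun t u htu =>
    sub_nonneg.1 ((norm_nonneg _).trans (hFΦ t u htu))
  have hquad : ∀ t u, t ≤ u →
      ‖F u - F t - (Φ u - Φ t) • T t‖ ≤ (Φ u - Φ t) * (A * N * |u - t|) := by
    intro t u htu
    refine le_of_tendsto_of_tendsto'
      (((hF u).sub (hF t)).sub (((hΦ u).sub (hΦ t)).smul (hT t))).norm
      (((hΦ u).sub (hΦ t)).mul (tendsto_index_bound N A u t)) fun k =>
        (h.norm_sub_sub_cumLength_smul_dir_le k (dyadicIdx_mono htu)).trans ?_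
    have h0 : 0 ≤ cumLength P k (dyadicIdx N k u) - cumLength P k (dyadicIdx N k t) :=
      (norm_nonneg _).trans (norm_sub_le_cumLength P k (dyadicIdx_mono htu))
    have := h.nonneg
    gcongr
    exact (le_abs_self _).trans (abs_dyadicIdx_sub_le N k u t)
  refine ⟨F, T, Φ, hFd, ?_, ?_, ?_, ?_, ?_, ?_, ?_, ?_⟩
  · intro t
    refine tendsto_nhds_unique (hF (t + 1)) ((hF t).congr fun k => ?_)
    rw [dyadicIdx_add_one, h.periodic]
  · exact fun t => mem_closure_of_tendsto (hF t) (Eventually.of_forall fun k => ⟨k, _, rfl⟩)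
  · exact fun t => tendsto_nhds_unique (hT t).norm
      (tendsto_const_nhds.congr fun k => (h.norm_dir k _).symm)
  · exact (LipschitzWith.of_dist_le' fun t u => by
      rw [dist_eq_norm, Real.dist_eq]; exact hTlip t u).continuous
  · exact (LipschitzWith.of_dist_le' fun t u => by
      rw [dist_eq_norm, Real.dist_eq]; exact hΦlip t u).continuous
  · intro t u htu
    obtain ⟨k, j, h1, h2⟩ := exists_dyadic_between h.pos htu
    have h3 : ((j : ℤ) : ℝ) / (N * 2 ^ k) ≤ ((j + 1 : ℤ) : ℝ) / (N * 2 ^ k) := by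
      gcongr; simp
    have h4 := hFΦ _ _ h3
    rw [hFd, hFd] at h4
    have h5 : 0 < ‖P k (j + 1) - P k j‖ := norm_pos_iff.2 (sub_ne_zero.2 (h.ne k j).symm)
    linarith [hmono h1, hmono h2]
  · intro t
    have h1 : Tendsto (fun k => cumLength P k (dyadicIdx N k (t + 1)) -
        cumLength P k (dyadicIdx N k t)) atTop (𝓝 (Φ (0 + 1) - Φ 0)) := by
      refine ((hΦ (0 + 1)).sub (hΦ 0)).congr fun k => ?_
      rw [dyadicIdx_add_one, dyadicIdx_add_one, h.cumLength_add_period, h.cumLength_add_period]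
    have h2 := tendsto_nhds_unique h1 ((hΦ (t + 1)).sub (hΦ t))
    rw [zero_add] at h2
    linarith
  · intro t u
    rcases le_total t u with htu | htu
    · rw [abs_of_nonneg (sub_nonneg.2 (hmono htu))]
      refine (hquad t u htu).trans ?_
      have h0 := sub_nonneg.2 (hmono htu)
      have h1 : 0 ≤ A * N * |u - t| := (norm_nonneg _).trans (hTlip u t)
      nlinarith
    · have h1 := hquad u t htu
      have h2 := hTlip u t
      have h0 := sub_nonneg.2 (hmono htu)
      rw [abs_sub_comm t u] at h1
      have e : F u - F t - (Φ u - Φ t) • T t =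
          -(F t - F u - (Φ t - Φ u) • T u) - (Φ t - Φ u) • (T u - T t) := by
        rw [← neg_sub (Φ t) (Φ u), neg_smul, smul_sub]; abel
      have h3 := norm_sub_le (-(F t - F u - (Φ t - Φ u) • T u)) ((Φ t - Φ u) • (T u - T t))
      rw [norm_neg, norm_smul, Real.norm_of_nonneg h0] at h3
      rw [e, abs_sub_comm (Φ u), abs_of_nonneg h0]
      nlinarith [mul_le_mul_of_nonneg_left h2 h0]

/-- A refining sequence of polygons runs through a closed regular `C¹` curve. -/
theorem exists_curve (h : IsRefining N P A) : ∃ (γ : ℝ → V) (φ : ℝ → ℝ),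
    ContDiff ℝ 1 γ ∧ (∀ t, deriv γ t ≠ 0) ∧ (∀ t, γ (t + 1) = γ t) ∧
    (∀ t, γ t ∈ closure {x | ∃ k j, P k j = x}) ∧
    Continuous φ ∧ StrictMono φ ∧ (∀ t, φ (t + 1) = φ t + 1) ∧
    ∀ (k : ℕ) (j : ℤ), γ (φ ((j : ℝ) / (N * 2 ^ k))) = P k j := by
  obtain ⟨F, T, Φ, hFd, hF1, hFcl, hT1, hTc, hΦc, hΦm, hΦ1, hquad⟩ := h.exists_limit_functions
  set L := Φ 1 - Φ 0 with hL
  have hLpos : 0 < L := sub_pos.2 (hΦm one_pos)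
  set φ : ℝ → ℝ := fun t => Φ t / L with hφ
  have hφ1 : ∀ t, φ (t + 1) = φ t + 1 := fun t => by
    simp only [hφ]; rw [hΦ1, add_div, div_self hLpos.ne']
  have hφm : StrictMono φ := fun t u htu => div_lt_div_of_pos_right (hΦm htu) hLpos
  have hφc : Continuous φ := hΦc.div_const L
  have hφn : ∀ n : ℕ, φ n = φ 0 + n ∧ φ (-n) = φ 0 - n := by
    intro n
    induction n with
    | zero => simp
    | succ n ih =>
      have h1 := hφ1 n
      have h2 := hφ1 (-(n + 1))
      rw [show -((n : ℝ) + 1) + 1 = -n by ring] at h2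
      push_cast
      constructor <;> linarith [ih.1, ih.2]
  have hsurj : Function.Surjective φ := by
    refine hφc.surjective ?_ ?_
    · refine tendsto_atTop_mono' atTop (f₁ := fun t => φ 0 + (t - 1)) ?_
        (tendsto_atTop_add_const_left _ _ (tendsto_atTop_add_const_right _ _ tendsto_id))
      filter_upwards [eventually_ge_atTop 0] with t ht
      have h1 := hφm.monotone (Nat.floor_le ht)
      rw [(hφn _).1] at h1
      linarith [Nat.lt_floor_add_one t]
    · refine tendsto_atBot_mono' atBot (f₂ := φ) (f₁ := fun t => φ 0 + (t + 1)) ?_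
        (tendsto_atBot_add_const_left _ _ (tendsto_atBot_add_const_right _ _ tendsto_id))
      filter_upwards [eventually_le_atBot 0] with t ht
      have h2 := Nat.floor_le (neg_nonneg.2 ht)
      have h1 := hφm.monotone (le_neg.1 h2)
      rw [(hφn _).2] at h1
      linarith [Nat.lt_floor_add_one (-t)]
  let ι : ℝ ≃o ℝ := hφm.orderIsoOfSurjective φ hsurj
  have hι : ∀ t, ι t = φ t := fun t => rfl
  set ψ : ℝ → ℝ := fun t => ι.symm t with hψ
  have hψφ : ∀ t, ψ (φ t) = t := fun t => ι.symm_apply_apply t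
  have hφψ : ∀ t, φ (ψ t) = t := fun t => ι.apply_symm_apply t
  have hψc : Continuous ψ := ι.symm.continuous
  have hΦψ : ∀ t, Φ (ψ t) = L * t := fun t => by
    have := hφψ t
    simp only [hφ] at this
    rw [div_eq_iff hLpos.ne'] at this
    linarith
  have hder : ∀ u, HasDerivAt (fun v => F (ψ v)) (L • T (ψ u)) u := by
    intro u
    rw [hasDerivAt_iff_isLittleO]
    have h1 : (fun v => F (ψ v) - F (ψ u) - (v - u) • L • T (ψ u)) =O[𝓝 u]
        fun v => (ψ v - ψ u) * (v - u) := by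
      refine Asymptotics.IsBigO.of_bound (2 * (A * N) * L) (Eventually.of_forall fun v => ?_)
      have h2 := hquad (ψ u) (ψ v)
      rw [hΦψ, hΦψ, ← mul_sub, abs_mul, abs_of_pos hLpos, mul_comm L (v - u), mul_smul] at h2
      refine h2.trans (le_of_eq ?_)
      rw [Real.norm_eq_abs, abs_mul]
      ring
    refine h1.trans_isLittleO ?_
    have h3 : (fun v => ψ v - ψ u) =o[𝓝 u] fun _ => (1 : ℝ) := by
      rw [Asymptotics.isLittleO_one_iff]
      simpa using (hψc.tendsto u).sub_const (ψ u)
    simpa using h3.mul_isBigO (Asymptotics.isBigO_refl (fun v => v - u) (𝓝 u))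
  refine ⟨fun u => F (ψ u), φ, ?_, ?_, ?_, fun t => hFcl _, hφc, hφm, hφ1, ?_⟩
  · rw [contDiff_one_iff_deriv]
    refine ⟨fun u => (hder u).differentiableAt, ?_⟩
    have : deriv (fun u => F (ψ u)) = fun u => L • T (ψ u) := funext fun u => (hder u).deriv
    rw [this]
    exact (hTc.comp hψc).const_smul L
  · intro u
    rw [(hder u).deriv]
    refine smul_ne_zero hLpos.ne' fun h0 => ?_
    have := hT1 (ψ u)
    rw [h0, norm_zero] at this
    exact zero_ne_one this
  · intro u
    have : ψ (u + 1) = ψ u + 1 := by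
      rw [← hψφ (ψ u + 1), hφ1, hφψ]
    simp only [this, hF1]
  · intro k j
    simp only [hψφ, hFd]

end IsRefining

/-! ### Subdivision in a model with local estimates -/

/-- The metric estimates on a model that the convergence proof uses: existence and size of the two
new edges, the apex angle, the dependence of the inserted point on the angle, and the comparison of
chords with exterior angles on a closed set that contains a given refining sequence. -/
structure HasLocalEstimates (M : Model) (B η : ℝ) : Prop where
  B_nonneg : 0 ≤ B
  η_pos : 0 < η
  gdist_self : ∀ p ∈ M.carrier, M.gdist p p = 0
  gdist_pos : ∀ p ∈ M.carrier, ∀ q ∈ M.carrier, M.goodEdge p q → 0 < M.gdist p q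
  ne_of_goodEdge : ∀ p q, M.goodEdge p q → p ≠ q
  insertPt_mem : ∀ p ∈ M.carrier, ∀ q ∈ M.carrier, M.goodEdge p q → ∀ α ∈ admissibleAngles,
    M.insertPt p q α ∈ M.carrier
  gdist_left_le : ∀ p ∈ M.carrier, ∀ q ∈ M.carrier, M.goodEdge p q → ∀ α ∈ admissibleAngles,
    M.gdist p q ≤ η →
    M.gdist p (M.insertPt p q α) ≤ M.gdist p q / 2 * (1 + B * (M.gdist p q + |Real.sin α|))
  gdist_right_le : ∀ p ∈ M.carrier, ∀ q ∈ M.carrier, M.goodEdge p q → ∀ α ∈ admissibleAngles,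
    M.gdist p q ≤ η →
    M.gdist (M.insertPt p q α) q ≤ M.gdist p q / 2 * (1 + B * (M.gdist p q + |Real.sin α|))
  abs_sin_le : ∀ p ∈ M.carrier, ∀ q ∈ M.carrier, M.goodEdge p q → ∀ α ∈ admissibleAngles,
    |Real.sin α| ≤ B * (|M.extAngle p (M.insertPt p q α) q| + M.gdist p q)
  gdist_insertPt_le : ∀ p ∈ M.carrier, ∀ q ∈ M.carrier, M.goodEdge p q → ∀ α ∈ admissibleAngles,
    ∀ β ∈ admissibleAngles, M.gdist p q ≤ η →
    M.gdist (M.insertPt p q α) (M.insertPt p q β) ≤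
      B * M.gdist p q * (M.gdist p q + |Real.sin α| + |Real.sin β|)
  exists_closed : ∀ (N : ℕ) (P : ℕ → ℤ → M.V) (C : ℝ), 0 < N → (∀ j, P 0 (j + N) = P 0 j) →
    (∀ k j, P (k + 1) (2 * j) = P k j) → (∀ k j, P k j ∈ M.carrier) →
    (∀ k j, M.gdist (P (k + 1) (2 * j)) (P (k + 1) (2 * j + 1)) ≤ C * (1 / 2) ^ k) →
    ∃ (S : Set M.V) (A : ℝ), 0 ≤ A ∧ IsClosed S ∧ S ⊆ M.carrier ∧ (∀ k j, P k j ∈ S) ∧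
      ∀ a ∈ S, ∀ p ∈ S, ∀ b ∈ S, M.goodEdge a p → M.goodEdge p b →
        ‖b - p‖ ≤ A * M.gdist p b ∧
        ‖chordDir p b - chordDir a p‖ ≤ |M.extAngle a p b| + A * (M.gdist a p + M.gdist p b)

theorem alphaMax_pos : 0 < alphaMax := by
  unfold alphaMax; linarith [Real.pi_gt_three]

theorem mul_mem_admissibleAngles {s a : ℝ} (hs : s = 1 ∨ s = -1) (ha : a ∈ admissibleAngles) :
    s * a ∈ admissibleAngles := by
  obtain ⟨h1, h2⟩ := ha
  rcases hs with rfl | rfl <;> constructor <;> linarith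

theorem clampAngle_mem (a : ℝ) : clampAngle a ∈ admissibleAngles :=
  ⟨le_max_left _ _, max_le (by linarith [alphaMax_pos]) (min_le_left _ _)⟩

theorem abs_clampAngle_le (a : ℝ) : |clampAngle a| ≤ |a| := by
  have h := alphaMax_pos
  have h1 := neg_abs_le a
  have h2 := le_abs_self a
  unfold clampAngle
  rw [abs_le]
  constructor
  · rcases le_total alphaMax a with h3 | h3
    · rw [min_eq_left h3]
      exact le_max_of_le_right (by linarith [abs_nonneg a])
    · rw [min_eq_right h3]
      exact le_max_of_le_right h1
  · exact max_le (by linarith [abs_nonneg a]) ((min_le_right _ _).trans h2)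

theorem abs_sin_mul_eq {s : ℝ} (hs : s = 1 ∨ s = -1) (a : ℝ) : |Real.sin (s * a)| = |Real.sin a| := by
  rcases hs with rfl | rfl <;> simp

/-- A sequence that is eventually almost halved in each step decays like `2 ^ (-k)`. -/
theorem exists_le_geometric_of_almost_halving {h : ℕ → ℝ} {η E : ℝ} (hη : 0 < η) (hE : 0 ≤ E)
    (h0 : ∀ k, 0 ≤ h k) (hlim : Tendsto h atTop (𝓝 0))
    (hstep : ∀ k, h k ≤ η → h (k + 1) ≤ h k / 2 * (1 + E * h k)) :
    ∃ C, 0 ≤ C ∧ ∀ k, h k ≤ C * (1 / 2) ^ k := by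
  obtain ⟨k₀, hk₀⟩ := eventually_atTop.1 ((hlim.eventually_le_const hη).and
    ((hlim.const_mul E).eventually_le_const (by simp : E * 0 < 1 / 2)))
  have hgeo : ∀ n, h (k₀ + n) ≤ h k₀ * (3 / 4) ^ n := by
    intro n
    induction n with
    | zero => simp
    | succ n ih =>
      have h1 := hstep (k₀ + n) (hk₀ _ (by omega)).1
      have h2 := (hk₀ (k₀ + n) (by omega)).2
      have h3 := h0 (k₀ + n)
      rw [← add_assoc, pow_succ]
      nlinarith
  have hexp : ∀ n, h (k₀ + n) ≤
      h k₀ * Real.exp (E * h k₀ * ∑ i ∈ Finset.range n, (3 / 4 : ℝ) ^ i) * (1 / 2) ^ n := by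
    intro n
    induction n with
    | zero => simp
    | succ n ih =>
      have h1 := hstep (k₀ + n) (hk₀ _ (by omega)).1
      have h2 : 1 + E * h (k₀ + n) ≤ Real.exp (E * h k₀ * (3 / 4) ^ n) := by
        have h3 := Real.add_one_le_exp (E * h k₀ * (3 / 4) ^ n)
        have h4 := mul_le_mul_of_nonneg_left (hgeo n) hE
        linarith
      have h5 := h0 (k₀ + n)
      have h6 := h0 k₀
      rw [← add_assoc, Finset.sum_range_succ, mul_add, Real.exp_add, pow_succ]
      calc h (k₀ + n + 1) ≤ h (k₀ + n) / 2 * (1 + E * h (k₀ + n)) := h1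
        _ ≤ h (k₀ + n) / 2 * Real.exp (E * h k₀ * (3 / 4) ^ n) := by gcongr
        _ ≤ (h k₀ * Real.exp (E * h k₀ * ∑ i ∈ Finset.range n, (3 / 4 : ℝ) ^ i) * (1 / 2) ^ n) / 2 *
            Real.exp (E * h k₀ * (3 / 4) ^ n) := by gcongr
        _ = _ := by ring
  have hsum : ∀ n, ∑ i ∈ Finset.range n, (3 / 4 : ℝ) ^ i ≤ 4 := by
    intro n
    have := geom_sum_eq (by norm_num : (3 / 4 : ℝ) ≠ 1) n
    rw [this, div_le_iff_of_neg (by norm_num)]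
    have : (0 : ℝ) ≤ (3 / 4) ^ n := by positivity
    linarith
  have hsn : 0 ≤ ∑ i ∈ Finset.range k₀, h i * 2 ^ i :=
    Finset.sum_nonneg fun i _ => mul_nonneg (h0 i) (by positivity)
  have hln : 0 ≤ h k₀ * Real.exp (E * h k₀ * 4) * 2 ^ k₀ := by
    have := h0 k₀
    positivity
  refine ⟨h k₀ * Real.exp (E * h k₀ * 4) * 2 ^ k₀ + ∑ i ∈ Finset.range k₀, h i * 2 ^ i,
    by linarith, fun k => ?_⟩
  have e2 : ∀ k : ℕ, (2 : ℝ) ^ k * (1 / 2 : ℝ) ^ k = 1 := fun k => by rw [← mul_pow]; norm_num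
  rcases lt_or_ge k k₀ with hk | hk
  · have h1 : h k * 2 ^ k ≤ ∑ i ∈ Finset.range k₀, h i * 2 ^ i :=
      Finset.single_le_sum (f := fun i => h i * 2 ^ i)
        (fun i _ => mul_nonneg (h0 i) (by positivity)) (Finset.mem_range.2 hk)
    calc h k = h k * 2 ^ k * (1 / 2) ^ k := by rw [mul_assoc, e2, mul_one]
      _ ≤ _ := by gcongr; linarith
  · obtain ⟨n, rfl⟩ := Nat.exists_eq_add_of_le hk
    have h6 := h0 k₀
    calc h (k₀ + n) ≤ _ := hexp n
      _ ≤ h k₀ * Real.exp (E * h k₀ * 4) * (1 / 2) ^ n := by gcongr; exact hsum n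
      _ = h k₀ * Real.exp (E * h k₀ * 4) * 2 ^ k₀ * (1 / 2) ^ (k₀ + n) := by
        rw [pow_add]; linear_combination (-h k₀ * Real.exp (E * h k₀ * 4) * (1 / 2) ^ n) * e2 k₀
      _ ≤ _ := by gcongr; linarith

section Polygon

variable {M : Model}

theorem subdivide_even (s : ℝ) (a : ℤ → ℝ) (P : ℤ → M.V) (j : ℤ) :
    subdivide M s a P (2 * j) = P j := by
  have h1 : 2 * j % 2 = 0 := by omega
  have h2 : 2 * j / 2 = j := by omega
  simp only [subdivide, h1, h2, if_true]

theorem subdivide_odd (s : ℝ) (a : ℤ → ℝ) (P : ℤ → M.V) (j : ℤ) :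
    subdivide M s a P (2 * j + 1) = M.insertPt (P j) (P (j + 1)) (s * a j) := by
  have h1 : (2 * j + 1) % 2 = 1 := by omega
  have h2 : (2 * j + 1) / 2 = j := by omega
  simp only [subdivide, h1, h2, one_ne_zero, if_false]

theorem subdivide_even' (s : ℝ) (a : ℤ → ℝ) (P : ℤ → M.V) (j : ℤ) :
    subdivide M s a P (2 * j + 1 + 1) = P (j + 1) := by
  rw [← subdivide_even s a P (j + 1)]; ring_nf

theorem subdivide_periodic {s : ℝ} {a : ℤ → ℝ} {P : ℤ → M.V} {n : ℕ} (hP : ∀ j, P (j + n) = P j)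
    (ha : ∀ j, a (j + n) = a j) (j : ℤ) :
    subdivide M s a P (j + (n * 2 : ℕ)) = subdivide M s a P j := by
  have h1 : (j + (n * 2 : ℕ)) % 2 = j % 2 := by push_cast; omega
  have h2 : (j + (n * 2 : ℕ)) / 2 = j / 2 + n := by push_cast; omega
  have h3 : j / 2 + (n : ℤ) + 1 = j / 2 + 1 + n := by ring
  simp only [subdivide, h1, h2, hP, ha, h3]

theorem delta_periodic {P : ℤ → M.V} {n : ℕ} (hP : ∀ j, P (j + n) = P j) (j : ℤ) :
    delta M P (j + n) = delta M P j := by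
  simp only [delta]
  rw [show j + (n : ℤ) - 1 = j - 1 + n by ring, show j + (n : ℤ) + 1 = j + 1 + n by ring, hP, hP, hP]

theorem edge_periodic {P : ℤ → M.V} {n : ℕ} (hP : ∀ j, P (j + n) = P j) (j : ℤ) :
    edge M P (j + n) = edge M P j := by
  simp only [edge]
  rw [show j + (n : ℤ) + 1 = j + 1 + n by ring, hP, hP]

theorem feature_periodic {P : ℤ → M.V} {n : ℕ} (hP : ∀ j, P (j + n) = P j) (m : ℕ) (j : ℤ) :
    feature M m P (j + n) = feature M m P j := by
  simp only [feature]
  rw [show j + (n : ℤ) - 1 = j - 1 + n by ring, show j + (n : ℤ) + 1 = j + 1 + n by ring,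
    show j + (n : ℤ) + 2 = j + 2 + n by ring]
  simp only [delta_periodic hP, edge_periodic hP]

theorem neuralIter_succ (s : ℝ) (f : (Fin 7 → ℝ) → ℝ) (N : ℕ) (P : ℤ → M.V) (k : ℕ) :
    neuralIter M s f N P (k + 1) = subdivide M s
      (fun j => f (feature M (N * 2 ^ k) (neuralIter M s f N P k) j)) (neuralIter M s f N P k) :=
  rfl

theorem neuralIter_periodic {s : ℝ} {f : (Fin 7 → ℝ) → ℝ} {N : ℕ} {P : ℤ → M.V}
    (hP : ∀ j, P (j + N) = P j) (k : ℕ) (j : ℤ) :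
    neuralIter M s f N P k (j + (N * 2 ^ k : ℕ)) = neuralIter M s f N P k j := by
  induction k generalizing j with
  | zero => simpa [neuralIter] using hP j
  | succ k ih =>
    rw [pow_succ, ← mul_assoc, neuralIter_succ]
    exact subdivide_periodic ih (fun j => by rw [feature_periodic ih]) j

theorem neuralIter_even (s : ℝ) (f : (Fin 7 → ℝ) → ℝ) (N : ℕ) (P : ℤ → M.V) (k : ℕ) (j : ℤ) :
    neuralIter M s f N P (k + 1) (2 * j) = neuralIter M s f N P k j := by
  rw [neuralIter_succ, subdivide_even]

theorem exists_forall_le_of_periodic {g : ℤ → ℝ} {n : ℕ} (hn : 0 < n) (hg : ∀ j, g (j + n) = g j) :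
    ∃ c, ∀ j, g j ≤ c := by
  have hmod : ∀ j, g (j % n) = g j := fun j => by
    have h := (show Function.Periodic g (n : ℤ) from hg).int_mul (j / n) (j % n)
    rw [← h]
    congr 1
    rw [mul_comm]
    exact Int.emod_add_mul_ediv j n
  obtain ⟨c, hc⟩ := ((Set.finite_Ico (0 : ℤ) n).image g).bddAbove
  refine ⟨c, fun j => ?_⟩
  rw [← hmod]
  exact hc ⟨_, ⟨Int.emod_nonneg _ (by omega), Int.emod_lt_of_pos _ (by omega)⟩, rfl⟩

theorem edge_le_meshWidth {P : ℤ → M.V} {n : ℕ} (hn : 0 < n) (hP : ∀ j, P (j + n) = P j) (j : ℤ) :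
    edge M P j ≤ meshWidth M n P := by
  have h := (show Function.Periodic (edge M P) (n : ℤ) from edge_periodic hP).int_mul (j / n) (j % n)
  have h2 : j % n + j / n * n = j := by
    rw [mul_comm]
    exact Int.emod_add_mul_ediv j n
  have h3 := Int.emod_nonneg j (by omega : (n : ℤ) ≠ 0)
  have h4 := Int.emod_lt_of_pos j (by omega : (0 : ℤ) < n)
  rw [Int.cast_id, h2] at h
  have h5 : (((⟨(j % n).toNat, by omega⟩ : Fin n) : ℕ) : ℤ) = j % n := by simp [h3]
  rw [h, ← h5]
  exact le_ciSup (f := fun i : Fin n => edge M P (i : ℕ)) (Set.finite_range _).bddAbove _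

theorem meshWidth_le {P : ℤ → M.V} {n : ℕ} (hn : 0 < n) {b : ℝ} (h : ∀ j, edge M P j ≤ b) :
    meshWidth M n P ≤ b := by
  have : Nonempty (Fin n) := ⟨⟨0, hn⟩⟩
  exact ciSup_le fun i => h _

theorem abs_delta_le {P : ℤ → M.V} {n : ℕ} {b : ℝ} {j : ℤ} (h : ‖angleFeature M n P j‖ ≤ b) :
    |delta M P j| ≤ Real.pi * b := by
  have h1 := (norm_le_pi_norm (angleFeature M n P j) 1).trans h
  have h2 : angleFeature M n P j 1 = delta M P j / Real.pi := rfl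
  rw [h2, norm_div, Real.norm_eq_abs, Real.norm_of_nonneg Real.pi_pos.le, div_le_iff₀ Real.pi_pos]
    at h1
  linarith

end Polygon

section Main

variable {M : Model} {B η : ℝ} {s : ℝ} {f : (Fin 7 → ℝ) → ℝ} {N : ℕ} {P : ℤ → M.V} {K : ℝ}

/-- The standing hypotheses on a subdivision sequence. -/
structure IsAdmissible (M : Model) (s : ℝ) (f : (Fin 7 → ℝ) → ℝ) (N : ℕ) (P : ℤ → M.V)
    (K : ℝ) : Prop where
  sign : s = 1 ∨ s = -1
  mem : ∀ x, f x ∈ admissibleAngles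
  closed : IsClosedPolygon M N P
  good : ∀ k j, M.goodEdge (neuralIter M s f N P k j) (neuralIter M s f N P k (j + 1))
  decay : AngleDecay M K N (neuralIter M s f N P)

namespace IsAdmissible

variable (H : IsAdmissible M s f N P K) (hM : HasLocalEstimates M B η)

include H

theorem card_pos (k : ℕ) : 0 < N * 2 ^ k := Nat.mul_pos H.closed.1 (by positivity)

theorem periodic (k : ℕ) (j : ℤ) :
    neuralIter M s f N P k (j + (N * 2 ^ k : ℕ)) = neuralIter M s f N P k j :=
  neuralIter_periodic H.closed.2.1 k j

theorem edge_le (k : ℕ) (j : ℤ) : edge M (neuralIter M s f N P k) j ≤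
    meshWidth M (N * 2 ^ k) (neuralIter M s f N P k) :=
  edge_le_meshWidth (H.card_pos k) (H.periodic k) j

theorem angle_mem (k : ℕ) (j : ℤ) :
    s * f (feature M (N * 2 ^ k) (neuralIter M s f N P k) j) ∈ admissibleAngles :=
  mul_mem_admissibleAngles H.sign (H.mem _)

theorem abs_delta_le (k : ℕ) (j : ℤ) : |delta M (neuralIter M s f N P k) j| ≤
    Real.pi * (K * meshWidth M (N * 2 ^ k) (neuralIter M s f N P k)) :=
  AngleSubdivision.abs_delta_le (H.decay.2 k j)

theorem abs_sin_classicalAngle_le (k : ℕ) (j : ℤ) :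
    |Real.sin (s * classicalAngle M 0 (neuralIter M s f N P k) j)| ≤
      Real.pi * K * meshWidth M (N * 2 ^ k) (neuralIter M s f N P k) := by
  rw [abs_sin_mul_eq H.sign]
  refine Real.abs_sin_le_abs.trans ((abs_clampAngle_le _).trans ?_)
  have h1 := abs_le.1 (H.abs_delta_le k j)
  have h2 := abs_le.1 (H.abs_delta_le k (j + 1))
  have h3 := (abs_nonneg _).trans (H.abs_delta_le k j)
  rw [abs_le]
  constructor <;> linarith

include hM

theorem mem_carrier (k : ℕ) (j : ℤ) : neuralIter M s f N P k j ∈ M.carrier := by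
  induction k generalizing j with
  | zero => exact H.closed.2.2 j
  | succ k ih =>
    rcases Int.even_or_odd' j with ⟨i, rfl | rfl⟩
    · rw [neuralIter_even]; exact ih i
    · rw [neuralIter_succ, subdivide_odd]
      exact hM.insertPt_mem _ (ih _) _ (ih _) (H.good k i) _ (H.angle_mem k i)

theorem edge_pos (k : ℕ) (j : ℤ) : 0 < edge M (neuralIter M s f N P k) j :=
  hM.gdist_pos _ (H.mem_carrier hM k _) _ (H.mem_carrier hM k _) (H.good k j)

theorem meshWidth_pos (k : ℕ) : 0 < meshWidth M (N * 2 ^ k) (neuralIter M s f N P k) :=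
  (H.edge_pos hM k 0).trans_le (H.edge_le k 0)

theorem K_nonneg : 0 ≤ K := by
  have h1 := (norm_nonneg _).trans (H.decay.2 0 0)
  exact nonneg_of_mul_nonneg_left h1 (H.meshWidth_pos hM 0)

/-- Any uniform bound for the insertion angles bounds the next mesh width. -/
theorem meshWidth_succ_le {k : ℕ} (hk : meshWidth M (N * 2 ^ k) (neuralIter M s f N P k) ≤ η)
    {σ : ℝ} (hσ : ∀ j, |Real.sin (s * f (feature M (N * 2 ^ k) (neuralIter M s f N P k) j))| ≤ σ) :
    meshWidth M (N * 2 ^ (k + 1)) (neuralIter M s f N P (k + 1)) ≤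
      meshWidth M (N * 2 ^ k) (neuralIter M s f N P k) / 2 *
        (1 + B * (meshWidth M (N * 2 ^ k) (neuralIter M s f N P k) + σ)) := by
  have hB := hM.B_nonneg
  refine meshWidth_le (H.card_pos (k + 1)) fun j => ?_
  rcases Int.even_or_odd' j with ⟨i, rfl | rfl⟩
  all_goals
    have h1 := H.edge_le k i
    have h2 := H.edge_pos hM k i
    have h3 := hσ i
    have h4 : edge M (neuralIter M s f N P k) i / 2 * (1 + B * (edge M (neuralIter M s f N P k) i +
        |Real.sin (s * f (feature M (N * 2 ^ k) (neuralIter M s f N P k) i))|)) ≤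
        meshWidth M (N * 2 ^ k) (neuralIter M s f N P k) / 2 *
        (1 + B * (meshWidth M (N * 2 ^ k) (neuralIter M s f N P k) + σ)) := by
      have h5 := H.meshWidth_pos hM k
      gcongr
    refine le_trans ?_ h4
    rw [edge, neuralIter_succ]
  · rw [subdivide_even, subdivide_odd]
    exact hM.gdist_left_le _ (H.mem_carrier hM k _) _ (H.mem_carrier hM k _) (H.good k i) _
      (H.angle_mem k i) (h1.trans hk)
  · rw [subdivide_even', subdivide_odd]
    exact hM.gdist_right_le _ (H.mem_carrier hM k _) _ (H.mem_carrier hM k _) (H.good k i) _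
      (H.angle_mem k i) (h1.trans hk)

theorem abs_sin_le {k : ℕ} (hk : meshWidth M (N * 2 ^ k) (neuralIter M s f N P k) ≤ η) (j : ℤ) :
    |Real.sin (s * f (feature M (N * 2 ^ k) (neuralIter M s f N P k) j))| ≤
      B * (Real.pi * K * (1 + B * (η + 1)) + 1) *
        meshWidth M (N * 2 ^ k) (neuralIter M s f N P k) := by
  have hB := hM.B_nonneg
  have hK := H.K_nonneg hM
  have hh := H.meshWidth_pos hM k
  have h1 := H.meshWidth_succ_le hM hk (σ := 1) fun j => Real.abs_sin_le_one _
  have h2 := H.abs_delta_le (k + 1) (2 * j + 1)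
  have h3 := hM.abs_sin_le _ (H.mem_carrier hM k _) _ (H.mem_carrier hM k _) (H.good k j) _
    (H.angle_mem k j)
  have h4 : delta M (neuralIter M s f N P (k + 1)) (2 * j + 1) =
      M.extAngle (neuralIter M s f N P k j)
        (M.insertPt (neuralIter M s f N P k j) (neuralIter M s f N P k (j + 1))
          (s * f (feature M (N * 2 ^ k) (neuralIter M s f N P k) j)))
        (neuralIter M s f N P k (j + 1)) := by
    rw [delta, add_sub_cancel_right, neuralIter_succ, subdivide_even, subdivide_even',
      subdivide_odd]
  have h5 := H.edge_le k j
  rw [edge] at h5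
  rw [← h4] at h3
  set h := meshWidth M (N * 2 ^ k) (neuralIter M s f N P k)
  set h' := meshWidth M (N * 2 ^ (k + 1)) (neuralIter M s f N P (k + 1))
  have h6 : h' ≤ h * (1 + B * (η + 1)) := by
    have h7 : h / 2 * (1 + B * (h + 1)) ≤ h / 2 * (1 + B * (η + 1)) := by gcongr
    have h8 : 0 ≤ h / 2 * (1 + B * (η + 1)) := by have := hM.η_pos; positivity
    linarith
  calc _ ≤ _ := h3
    _ ≤ B * (Real.pi * (K * (h * (1 + B * (η + 1)))) + h) := by
      gcongr
      exact h2.trans (by gcongr)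
    _ = _ := by ring

theorem proximity {k : ℕ} (hk : meshWidth M (N * 2 ^ k) (neuralIter M s f N P k) ≤ η) (j : ℤ) :
    M.gdist (neuralStep M s f (N * 2 ^ k) (neuralIter M s f N P k) j)
        (fourPointStep M s (neuralIter M s f N P k) j) ≤
      B * (1 + B * (Real.pi * K * (1 + B * (η + 1)) + 1) + Real.pi * K) *
        meshWidth M (N * 2 ^ k) (neuralIter M s f N P k) ^ 2 := by
  have hB := hM.B_nonneg
  have hK := H.K_nonneg hM
  have hη := hM.η_pos
  have hh := H.meshWidth_pos hM k
  rw [neuralStep, fourPointStep]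
  rcases Int.even_or_odd' j with ⟨i, rfl | rfl⟩
  · rw [subdivide_even, subdivide_even, hM.gdist_self _ (H.mem_carrier hM k i)]
    positivity
  · rw [subdivide_odd, subdivide_odd]
    have h1 := H.edge_le k i
    have h2 := H.edge_pos hM k i
    refine (hM.gdist_insertPt_le _ (H.mem_carrier hM k _) _ (H.mem_carrier hM k _) (H.good k i) _
      (H.angle_mem k i) _ (mul_mem_admissibleAngles H.sign (clampAngle_mem _))
      (h1.trans hk)).trans ?_
    have h3 := H.abs_sin_le hM hk i
    have h4 := H.abs_sin_classicalAngle_le k i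
    rw [edge] at h1 h2
    calc _ ≤ B * meshWidth M (N * 2 ^ k) (neuralIter M s f N P k) *
          (meshWidth M (N * 2 ^ k) (neuralIter M s f N P k) +
          B * (Real.pi * K * (1 + B * (η + 1)) + 1) *
            meshWidth M (N * 2 ^ k) (neuralIter M s f N P k) +
          Real.pi * K * meshWidth M (N * 2 ^ k) (neuralIter M s f N P k)) := by
            gcongr
            exact h4
      _ = _ := by ring

theorem exists_proximity : ∃ C' : ℝ, ∀ k j,
    M.gdist (neuralStep M s f (N * 2 ^ k) (neuralIter M s f N P k) j)
        (fourPointStep M s (neuralIter M s f N P k) j) ≤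
      C' * meshWidth M (N * 2 ^ k) (neuralIter M s f N P k) ^ 2 := by
  have hb : ∀ k, ∃ c, ∀ j, M.gdist (neuralStep M s f (N * 2 ^ k) (neuralIter M s f N P k) j)
      (fourPointStep M s (neuralIter M s f N P k) j) ≤ c := fun k => by
    refine exists_forall_le_of_periodic (n := N * 2 ^ k * 2)
      (Nat.mul_pos (H.card_pos k) two_pos) fun j => ?_
    rw [neuralStep, fourPointStep, subdivide_periodic (H.periodic k) fun j => ?_,
      subdivide_periodic (H.periodic k) fun j => ?_]
    · have e : ∀ i, j + ((N * 2 ^ k : ℕ) : ℤ) + i = j + i + (N * 2 ^ k : ℕ) := fun i => by ring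
      simp only [classicalAngle, sub_eq_add_neg, e, delta_periodic (H.periodic k)]
    · rw [feature_periodic (H.periodic k)]
  choose c hc using hb
  obtain ⟨k₀, hk₀⟩ := eventually_atTop.1 (H.decay.1.eventually_le_const hM.η_pos)
  set D := B * (1 + B * (Real.pi * K * (1 + B * (η + 1)) + 1) + Real.pi * K) with hD
  have hD0 : 0 ≤ D := by
    have hB := hM.B_nonneg
    have hK := H.K_nonneg hM
    have hη := hM.η_pos
    positivity
  have hsum : 0 ≤ ∑ i ∈ Finset.range k₀,
      |c i| / meshWidth M (N * 2 ^ i) (neuralIter M s f N P i) ^ 2 := by positivity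
  refine ⟨D + ∑ i ∈ Finset.range k₀,
    |c i| / meshWidth M (N * 2 ^ i) (neuralIter M s f N P i) ^ 2, fun k j => ?_⟩
  have hh := H.meshWidth_pos hM k
  rcases lt_or_ge k k₀ with hk | hk
  · have h1 : |c k| / meshWidth M (N * 2 ^ k) (neuralIter M s f N P k) ^ 2 ≤
        ∑ i ∈ Finset.range k₀, |c i| / meshWidth M (N * 2 ^ i) (neuralIter M s f N P i) ^ 2 :=
      Finset.single_le_sum
        (f := fun i => |c i| / meshWidth M (N * 2 ^ i) (neuralIter M s f N P i) ^ 2)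
        (fun i _ => by positivity) (Finset.mem_range.2 hk)
    rw [div_le_iff₀ (by positivity)] at h1
    refine ((hc k j).trans (le_abs_self _)).trans (h1.trans ?_)
    gcongr
    linarith
  · refine (H.proximity hM (hk₀ k hk) j).trans ?_
    gcongr
    linarith

theorem exists_meshWidth_le : ∃ C, 0 ≤ C ∧ ∀ k,
    meshWidth M (N * 2 ^ k) (neuralIter M s f N P k) ≤ C * (1 / 2) ^ k := by
  have hB := hM.B_nonneg
  have hK := H.K_nonneg hM
  have hη := hM.η_pos
  refine exists_le_geometric_of_almost_halving hM.η_pos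
    (E := B * (1 + B * (Real.pi * K * (1 + B * (η + 1)) + 1))) (by positivity)
    (fun k => (H.meshWidth_pos hM k).le) H.decay.1 fun k hk => ?_
  refine (H.meshWidth_succ_le hM hk fun j => H.abs_sin_le hM hk j).trans (le_of_eq ?_)
  ring

theorem hasC1LimitCurve [CompleteSpace M.V] : HasC1LimitCurve M N (neuralIter M s f N P) := by
  obtain ⟨C, hC0, hC⟩ := H.exists_meshWidth_le hM
  obtain ⟨S, A, hA, hScl, hSc, hS, hest⟩ := hM.exists_closed N (neuralIter M s f N P) C H.closed.1
    (fun j => H.closed.2.1 j) (neuralIter_even s f N P) (H.mem_carrier hM) fun k j => by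
      refine (H.edge_le (k + 1) (2 * j)).trans ((hC _).trans ?_)
      rw [pow_succ]
      nlinarith [mul_nonneg hC0 (by positivity : (0 : ℝ) ≤ (1 / 2) ^ k)]
  have hK := H.K_nonneg hM
  have hgd : ∀ k j, M.gdist (neuralIter M s f N P k j) (neuralIter M s f N P k (j + 1)) ≤
      C * (1 / 2) ^ k := fun k j => (H.edge_le k j).trans (hC k)
  have hR : IsRefining N (neuralIter M s f N P) (Real.pi * K * C + 2 * A * C) :=
    { pos := H.closed.1
      periodic := H.periodic
      even := neuralIter_even s f N P
      ne := fun k j => hM.ne_of_goodEdge _ _ (H.good k j)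
      chord_le := fun k j => by
        refine (hest _ (hS k (j - 1)) _ (hS k j) _ (hS k (j + 1)) ?_ (H.good k j)).1.trans ?_
        · simpa using H.good k (j - 1)
        · have h1 := mul_le_mul_of_nonneg_left (hgd k j) hA
          have h2 : 0 ≤ (Real.pi * K * C + A * C) * (1 / 2) ^ k := by positivity
          linarith
      turn_le := fun k j => by
        refine (hest _ (hS k j) _ (hS k (j + 1)) _ (hS k (j + 1 + 1)) (H.good k j)
          (H.good k (j + 1))).2.trans ?_
        have h1 := mul_le_mul_of_nonneg_left (add_le_add (hgd k j) (hgd k (j + 1))) hA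
        have h2 := H.abs_delta_le k (j + 1)
        rw [delta, add_sub_cancel_right] at h2
        have h3 := mul_le_mul_of_nonneg_left (hC k) (mul_nonneg Real.pi_pos.le hK)
        linarith }
  obtain ⟨γ, φ, h1, h2, h3, h4, h5, h6, h7, h8⟩ := hR.exists_curve
  refine ⟨γ, φ, h1, h2, h3, fun t => hSc ?_, h5, h6, h7, fun ε hε => Eventually.of_forall ?_⟩
  · refine hScl.closure_subset_iff.2 ?_ (h4 t)
    rintro x ⟨k, j, rfl⟩
    exact hS k j
  · intro k j
    rw [h8, hM.gdist_self _ (H.mem_carrier hM k j)]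
    exact hε

end IsAdmissible

end Main

/-! ### Angles -/

theorem two_thirds_le_cos {α : ℝ} (h : α ∈ admissibleAngles) : 2 / 3 ≤ Real.cos α := by
  obtain ⟨h1, h2⟩ := h
  have h3 : |α| ≤ Real.pi / 4 := by
    unfold alphaMax at h1 h2
    rw [abs_le]; constructor <;> linarith
  have h4 := Real.cos_le_cos_of_nonneg_of_le_pi (abs_nonneg α)
    (by linarith [Real.pi_pos] : Real.pi / 4 ≤ Real.pi) h3
  rw [Real.cos_abs, Real.cos_pi_div_four] at h4
  have h5 : 4 / 3 ≤ √2 := Real.le_sqrt_of_sq_le (by norm_num)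
  linarith

theorem inv_cos_le {α : ℝ} (h : α ∈ admissibleAngles) :
    (Real.cos α)⁻¹ ≤ 1 + 3 / 2 * |Real.sin α| := by
  have h1 := two_thirds_le_cos h
  have h2 := Real.cos_le_one α
  have h3 := Real.sin_sq_add_cos_sq α
  have h4 := Real.abs_sin_le_one α
  have h5 := abs_nonneg (Real.sin α)
  rw [← sq_abs] at h3
  rw [inv_le_iff_one_le_mul₀ (by linarith)]
  nlinarith

theorem inv_cos_le_three_halves {α : ℝ} (h : α ∈ admissibleAngles) : (Real.cos α)⁻¹ ≤ 3 / 2 := by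
  rw [inv_le_comm₀ (by linarith [two_thirds_le_cos h]) (by norm_num)]
  have := two_thirds_le_cos h
  norm_num
  linarith

theorem two_sub_two_mul_le_sq_atan2 {x y : ℝ} (h : x ^ 2 + y ^ 2 = 1) :
    2 - 2 * x ≤ atan2 y x ^ 2 := by
  have hn : ‖(⟨x, y⟩ : ℂ)‖ = 1 := by
    rw [Complex.norm_eq_sqrt_sq_add_sq, h, Real.sqrt_one]
  have h1 := Real.norm_exp_I_mul_ofReal_sub_one_le (x := atan2 y x)
  have h2 := Complex.norm_mul_exp_arg_mul_I ⟨x, y⟩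
  rw [hn, Complex.ofReal_one, one_mul, mul_comm] at h2
  rw [atan2, h2, Real.norm_eq_abs] at h1
  have h3 : ‖(⟨x, y⟩ : ℂ) - 1‖ ^ 2 = 2 - 2 * x := by
    rw [Complex.sq_norm, Complex.normSq_apply]
    simp
    linarith
  rw [← h3, atan2, ← sq_abs (Complex.arg _)]
  gcongr

theorem norm_sub_le_abs_planeAngle {v w : ℂ} (hv : ‖v‖ = 1) (hw : ‖w‖ = 1) :
    ‖w - v‖ ≤ |planeAngle v w| := by
  have h1 : v.re ^ 2 + v.im ^ 2 = 1 := by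
    have := Complex.sq_norm v
    rw [hv, Complex.normSq_apply] at this
    linarith
  have h2 : w.re ^ 2 + w.im ^ 2 = 1 := by
    have := Complex.sq_norm w
    rw [hw, Complex.normSq_apply] at this
    linarith
  have h3 := two_sub_two_mul_le_sq_atan2 (x := v.re * w.re + v.im * w.im)
    (y := v.re * w.im - v.im * w.re)
    (by linear_combination (w.re ^ 2 + w.im ^ 2) * h1 + h2)
  have h4 : ‖w - v‖ ^ 2 = 2 - 2 * (v.re * w.re + v.im * w.im) := by
    rw [Complex.sq_norm, Complex.normSq_apply]
    simp
    linear_combination h1 + h2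
  rw [← h4] at h3
  rw [← sq_abs (atan2 _ _)] at h3
  exact (sq_le_sq₀ (norm_nonneg _) (abs_nonneg _)).1 h3

theorem norm_rot (α : ℝ) (v : ℂ) : ‖rot α v‖ = ‖v‖ := by
  rw [rot, norm_mul, Complex.norm_exp_ofReal_mul_I, one_mul]

theorem rot_eq (α : ℝ) (v : ℂ) : rot α v = (Real.cos α + Real.sin α * Complex.I) * v := by
  rw [rot, Complex.exp_mul_I, Complex.ofReal_cos, Complex.ofReal_sin]

/-! ### The Euclidean plane -/

theorem eDir_eq_chordDir (p q : ℂ) : eDir p q = chordDir p q := by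
  rw [eDir, chordDir, Complex.real_smul, Complex.ofReal_inv, div_eq_inv_mul]

theorem chordDir_add_mul {p u : ℂ} {r : ℝ} (hr : 0 < r) (hu : ‖u‖ = 1) :
    chordDir p (p + r * u) = u := by
  have h : (r : ℂ) ≠ 0 := by exact_mod_cast hr.ne'
  rw [chordDir, add_sub_cancel_left, norm_mul, hu, Complex.norm_real, Real.norm_of_nonneg hr.le,
    Complex.real_smul, mul_one, Complex.ofReal_inv, inv_mul_cancel_left₀ h]

/-- Vertex insertion of the Euclidean plane. -/
def eInsert (p q : ℂ) (α : ℝ) : ℂ :=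
  p + ((‖q - p‖ / (2 * Real.cos α) : ℝ) : ℂ) * rot α (eDir p q)

theorem norm_eDir {p q : ℂ} (h : p ≠ q) : ‖eDir p q‖ = 1 := by
  rw [eDir_eq_chordDir, norm_chordDir h]

theorem eInsert_add (p q : ℂ) {α : ℝ} (h : Real.cos α ≠ 0) :
    eInsert p q α + ((‖q - p‖ / (2 * Real.cos α) : ℝ) : ℂ) * rot (-α) (eDir p q) = q := by
  have h1 : (‖q - p‖ : ℂ) * eDir p q = q - p := by
    rw [eDir_eq_chordDir, ← Complex.real_smul, norm_smul_chordDir]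
  have h2 : ((‖q - p‖ / (2 * Real.cos α) : ℝ) : ℂ) * (2 * Real.cos α) = ‖q - p‖ := by
    rw [← Complex.ofReal_ofNat, ← Complex.ofReal_mul, ← Complex.ofReal_mul,
      div_mul_cancel₀ _ (mul_ne_zero two_ne_zero h)]
  rw [eInsert, rot_eq, rot_eq, Real.cos_neg, Real.sin_neg, Complex.ofReal_neg]
  linear_combination h1 + eDir p q * h2

theorem eInsert_eq (p q : ℂ) {α : ℝ} (h : Real.cos α ≠ 0) :
    eInsert p q α =
      p + (‖q - p‖ / 2 : ℝ) * (1 + (Real.sin α / Real.cos α : ℝ) * Complex.I) * eDir p q := by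
  have h2 : (Real.cos α : ℂ) ≠ 0 := by exact_mod_cast h
  rw [eInsert, rot_eq]
  push_cast at h2 ⊢
  field_simp

theorem euclidean_length_le (p q : ℂ) {α : ℝ} (hα : α ∈ admissibleAngles) :
    ‖q - p‖ / (2 * Real.cos α) ≤ ‖q - p‖ / 2 * (1 + 2 * (‖q - p‖ + |Real.sin α|)) := by
  have h1 := inv_cos_le hα
  have h2 := norm_nonneg (q - p)
  rw [div_mul_eq_div_div, div_eq_mul_inv (‖q - p‖ / 2)]
  gcongr
  linarith [abs_nonneg (Real.sin α)]

theorem norm_eInsert_sub {p q : ℂ} (h : p ≠ q) {α : ℝ} (hα : α ∈ admissibleAngles) :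
    ‖eInsert p q α - p‖ = ‖q - p‖ / (2 * Real.cos α) := by
  have hc := two_thirds_le_cos hα
  rw [eInsert, add_sub_cancel_left, norm_mul, norm_rot, norm_eDir h, mul_one, Complex.norm_real,
    Real.norm_of_nonneg (by positivity)]

theorem norm_sub_eInsert {p q : ℂ} (h : p ≠ q) {α : ℝ} (hα : α ∈ admissibleAngles) :
    ‖q - eInsert p q α‖ = ‖q - p‖ / (2 * Real.cos α) := by
  have hc := two_thirds_le_cos hα
  rw [sub_eq_iff_eq_add'.2 (eInsert_add p q (α := α) (by positivity)).symm, norm_mul,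
    norm_rot, norm_eDir h, mul_one, Complex.norm_real, Real.norm_of_nonneg (by positivity)]

theorem abs_sin_le_planeAngle_eInsert {p q : ℂ} (h : p ≠ q) {α : ℝ} (hα : α ∈ admissibleAngles) :
    2 * |Real.sin α| ≤ |planeAngle (eDir p (eInsert p q α)) (eDir (eInsert p q α) q)| := by
  have hc := two_thirds_le_cos hα
  have hl : 0 < ‖q - p‖ := norm_pos_iff.2 (sub_ne_zero.2 h.symm)
  have hr : 0 < ‖q - p‖ / (2 * Real.cos α) := by positivity
  have h1 : eDir p (eInsert p q α) = rot α (eDir p q) := by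
    rw [eDir_eq_chordDir p, eInsert, chordDir_add_mul hr (by rw [norm_rot, norm_eDir h])]
  have h2 : eDir (eInsert p q α) q = rot (-α) (eDir p q) := by
    have := chordDir_add_mul (p := eInsert p q α) hr (u := rot (-α) (eDir p q))
      (by rw [norm_rot, norm_eDir h])
    rwa [eInsert_add p q (by positivity), ← eDir_eq_chordDir] at this
  have h3 := norm_sub_le_abs_planeAngle (v := eDir p (eInsert p q α)) (w := eDir (eInsert p q α) q)
    (by rw [h1, norm_rot, norm_eDir h]) (by rw [h2, norm_rot, norm_eDir h])
  have h4 : ‖eDir (eInsert p q α) q - eDir p (eInsert p q α)‖ = 2 * |Real.sin α| := by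
    have : eDir (eInsert p q α) q - eDir p (eInsert p q α) =
        ((-2 * Real.sin α : ℝ) : ℂ) * Complex.I * eDir p q := by
      rw [h1, h2, rot_eq, rot_eq, Real.cos_neg, Real.sin_neg]
      push_cast
      ring
    rw [this, norm_mul, norm_mul, norm_eDir h, Complex.norm_I, Complex.norm_real, Real.norm_eq_abs,
      abs_mul]
    norm_num
  linarith

theorem norm_eInsert_sub_eInsert_le {p q : ℂ} (h : p ≠ q) {α β : ℝ} (hα : α ∈ admissibleAngles)
    (hβ : β ∈ admissibleAngles) :
    ‖eInsert p q β - eInsert p q α‖ ≤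
      2 * ‖q - p‖ * (‖q - p‖ + |Real.sin α| + |Real.sin β|) := by
  have hcα := two_thirds_le_cos hα
  have hcβ := two_thirds_le_cos hβ
  have h1 : ∀ γ, γ ∈ admissibleAngles → |Real.sin γ / Real.cos γ| ≤ 3 / 2 * |Real.sin γ| := by
    intro γ hγ
    have h2 := inv_cos_le_three_halves hγ
    have h3 := two_thirds_le_cos hγ
    rw [div_eq_mul_inv, abs_mul, abs_of_nonneg (by positivity : 0 ≤ (Real.cos γ)⁻¹), mul_comm]
    gcongr
  have h2 : eInsert p q β - eInsert p q α =
      ((‖q - p‖ / 2 * (Real.sin β / Real.cos β - Real.sin α / Real.cos α) : ℝ) : ℂ) *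
        Complex.I * eDir p q := by
    rw [eInsert_eq p q (by positivity), eInsert_eq p q (by positivity)]
    push_cast
    ring
  rw [h2, norm_mul, norm_mul, norm_eDir h, Complex.norm_I, Complex.norm_real, Real.norm_eq_abs,
    abs_mul, abs_of_nonneg (by positivity : 0 ≤ ‖q - p‖ / 2)]
  have h3 := abs_sub (Real.sin β / Real.cos β) (Real.sin α / Real.cos α)
  have h4 := h1 α hα
  have h5 := h1 β hβ
  have h6 := norm_nonneg (q - p)
  have h7 := abs_nonneg (Real.sin α)
  have h8 := abs_nonneg (Real.sin β)
  rw [mul_one, mul_one]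
  calc _ ≤ ‖q - p‖ / 2 * (3 / 2 * |Real.sin β| + 3 / 2 * |Real.sin α|) := by gcongr; linarith
    _ ≤ _ := by nlinarith [mul_nonneg h6 h6, mul_nonneg h6 h7, mul_nonneg h6 h8]

theorem euclidean_chord_estimates {a p b : ℂ} (hap : a ≠ p) (hpb : p ≠ b) :
    ‖b - p‖ ≤ 1 * ‖b - p‖ ∧ ‖chordDir p b - chordDir a p‖ ≤
      |planeAngle (eDir a p) (eDir p b)| + 1 * (‖p - a‖ + ‖b - p‖) := by
  have h1 := norm_sub_le_abs_planeAngle (norm_eDir hap) (norm_eDir hpb)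
  rw [← eDir_eq_chordDir, ← eDir_eq_chordDir]
  constructor
  · linarith
  · linarith [norm_nonneg (p - a), norm_nonneg (b - p)]

theorem hasLocalEstimates_euclideanPlane : HasLocalEstimates euclideanPlane 2 1 where
  B_nonneg := zero_le_two
  η_pos := one_pos
  gdist_self := fun (p : ℂ) _ => show ‖p - p‖ = 0 by simp
  gdist_pos := fun _ _ _ _ h => norm_pos_iff.2 (sub_ne_zero.2 (Ne.symm h))
  ne_of_goodEdge := fun _ _ h => h
  insertPt_mem := fun _ _ _ _ _ _ _ => Set.mem_univ _
  gdist_left_le := fun p _ q _ h _ hα _ =>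
    (norm_eInsert_sub h hα).trans_le (euclidean_length_le p q hα)
  gdist_right_le := fun p _ q _ h _ hα _ =>
    (norm_sub_eInsert h hα).trans_le (euclidean_length_le p q hα)
  abs_sin_le := fun (p : ℂ) _ (q : ℂ) _ h α hα => by
    have h1 := abs_sin_le_planeAngle_eInsert h hα
    change |Real.sin α| ≤ 2 *
      (|planeAngle (eDir p (eInsert p q α)) (eDir (eInsert p q α) q)| + ‖q - p‖)
    linarith [abs_nonneg (Real.sin α), norm_nonneg (q - p)]
  gdist_insertPt_le := fun _ _ _ _ h _ hα _ hβ _ => norm_eInsert_sub_eInsert_le h hα hβ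
  exists_closed := fun _ _ _ _ _ _ _ _ =>
    ⟨Set.univ, 1, zero_le_one, isClosed_univ, subset_rfl, fun _ _ => Set.mem_univ _,
      fun _ _ _ _ _ _ hap hpb => euclidean_chord_estimates hap hpb⟩

/-! ### The unit sphere -/

theorem inner_eq_coords (v w : R3) : inner ℝ v w = v 0 * w 0 + v 1 * w 1 + v 2 * w 2 := by
  rw [PiLp.inner_apply, Fin.sum_univ_three]
  simp only [RCLike.inner_apply, conj_trivial]
  ring

theorem cross_coords (v w : R3) : cross v w 0 = v 1 * w 2 - v 2 * w 1 ∧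
    cross v w 1 = v 2 * w 0 - v 0 * w 2 ∧ cross v w 2 = v 0 * w 1 - v 1 * w 0 := by
  simp [cross, crossProduct]

theorem inner_cross_self_left (v w : R3) : inner ℝ v (cross v w) = 0 := by
  obtain ⟨h0, h1, h2⟩ := cross_coords v w
  rw [inner_eq_coords, h0, h1, h2]
  ring

theorem inner_cross_self_right (v w : R3) : inner ℝ w (cross v w) = 0 := by
  obtain ⟨h0, h1, h2⟩ := cross_coords v w
  rw [inner_eq_coords, h0, h1, h2]
  ring

theorem inner_cross_cross (v w : R3) : inner ℝ (cross v w) (cross v w) =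
    inner ℝ v v * inner ℝ w w - inner ℝ v w ^ 2 := by
  obtain ⟨h0, h1, h2⟩ := cross_coords v w
  simp only [inner_eq_coords, h0, h1, h2]
  ring

/-- The Gram determinant of three vectors. -/
theorem inner_cross_sq (u v w : R3) : inner ℝ (cross u v) w ^ 2 =
    inner ℝ u u * inner ℝ v v * inner ℝ w w + 2 * inner ℝ u v * inner ℝ v w * inner ℝ u w -
      inner ℝ u u * inner ℝ v w ^ 2 - inner ℝ v v * inner ℝ u w ^ 2 -
      inner ℝ w w * inner ℝ u v ^ 2 := by
  obtain ⟨h0, h1, h2⟩ := cross_coords u v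
  simp only [inner_eq_coords, h0, h1, h2]
  ring

theorem norm_sub_le_abs_atan2 {u w p : R3} (hu : ‖u‖ = 1) (hw : ‖w‖ = 1) (hp : ‖p‖ = 1)
    (hup : inner ℝ u p = 0) (hwp : inner ℝ w p = 0) :
    ‖w - u‖ ≤ |atan2 (inner ℝ (cross u w) p) (inner ℝ u w)| := by
  have h1 := two_sub_two_mul_le_sq_atan2 (x := inner ℝ u w) (y := inner ℝ (cross u w) p) (by
    rw [inner_cross_sq, real_inner_self_eq_norm_sq, real_inner_self_eq_norm_sq,
      real_inner_self_eq_norm_sq, hu, hw, hp, hup, hwp]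
    ring)
  have h2 : ‖w - u‖ ^ 2 = 2 - 2 * inner ℝ u w := by
    rw [norm_sub_sq_real, hu, hw, real_inner_comm]
    ring
  rw [← h2, ← sq_abs (atan2 _ _)] at h1
  exact (sq_le_sq₀ (norm_nonneg _) (abs_nonneg _)).1 h1

theorem sDist_comm (p q : R3) : sDist p q = sDist q p := by rw [sDist, sDist, real_inner_comm]

theorem inner_sDir {p : R3} (hp : ‖p‖ = 1) (q : R3) : inner ℝ p (sDir p q) = 0 := by
  rw [sDir, real_inner_smul_right, inner_sub_right, real_inner_smul_right,
    real_inner_self_eq_norm_sq, hp]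
  ring

section SpherePair

variable {p q : R3} (hp : ‖p‖ = 1) (hq : ‖q‖ = 1)

include hp hq

theorem inner_mem_Icc : -1 ≤ inner ℝ p q ∧ inner ℝ p q ≤ 1 := by
  have := abs_le.1 (abs_real_inner_le_norm p q)
  rwa [hp, hq, one_mul] at this

theorem cos_sDist : Real.cos (sDist p q) = inner ℝ p q :=
  Real.cos_arccos (inner_mem_Icc hp hq).1 (inner_mem_Icc hp hq).2

theorem norm_sub_sq_eq : ‖q - p‖ ^ 2 = 2 - 2 * inner ℝ p q := by
  rw [norm_sub_sq_real, hp, hq, real_inner_comm]; ring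

theorem norm_sub_le_sDist : ‖q - p‖ ≤ sDist p q := by
  have h1 := norm_sub_sq_eq hp hq
  have h2 := Real.one_sub_sq_div_two_le_cos (x := sDist p q)
  rw [cos_sDist hp hq] at h2
  have h0 : 0 ≤ sDist p q := Real.arccos_nonneg _
  exact (sq_le_sq₀ (norm_nonneg _) h0).1 (by linarith)

theorem sDist_le_two_mul_norm_sub : sDist p q ≤ 2 * ‖q - p‖ := by
  have h0 : 0 ≤ sDist p q := Real.arccos_nonneg _
  have h1 := norm_sub_sq_eq hp hq
  have h2 : Real.cos (sDist p q) ≤ 1 - 2 / Real.pi ^ 2 * sDist p q ^ 2 :=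
    Real.cos_le_one_sub_mul_cos_sq (by rw [abs_of_nonneg h0]; exact Real.arccos_le_pi _)
  rw [cos_sDist hp hq] at h2
  have h3 : 1 / 4 ≤ 4 / Real.pi ^ 2 := by
    rw [div_le_div_iff₀ (by norm_num) (by positivity)]
    nlinarith [Real.pi_le_four, Real.pi_pos]
  have h4 := mul_le_mul_of_nonneg_right h3 (sq_nonneg (sDist p q))
  refine (sq_le_sq₀ h0 (by positivity)).1 ?_
  rw [mul_pow, h1]
  have h5 : 4 / Real.pi ^ 2 * sDist p q ^ 2 = 2 * (2 / Real.pi ^ 2 * sDist p q ^ 2) := by ring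
  linarith

theorem norm_tangent : ‖q - inner ℝ p q • p‖ = Real.sin (sDist p q) := by
  rw [sDist, Real.sin_arccos, eq_comm, Real.sqrt_eq_iff_eq_sq _ (norm_nonneg _), norm_sub_sq_real,
    norm_smul, real_inner_smul_right, hp, hq, Real.norm_eq_abs, mul_one, sq_abs,
    real_inner_comm p q]
  · ring
  · nlinarith [inner_mem_Icc hp hq]

theorem norm_chordDir_sub_sDir_le (hne : p ≠ q) :
    ‖chordDir p q - sDir p q‖ ≤ sDist p q := by
  have hpos : 0 < ‖q - p‖ := norm_pos_iff.2 (sub_ne_zero.2 hne.symm)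
  refine (norm_inv_smul_sub_le (v := q - p) (w := q - inner ℝ p q • p)
    (norm_pos_iff.1 hpos)).trans (le_trans ?_ (norm_sub_le_sDist hp hq))
  have h1 : q - p - (q - inner ℝ p q • p) = (inner ℝ p q - 1) • p := by
    rw [sub_smul, one_smul]; abel
  have h2 := norm_sub_sq_eq hp hq
  have h3 := (inner_mem_Icc hp hq).2
  rw [h1, norm_smul, hp, Real.norm_eq_abs, abs_of_nonpos (by linarith), div_le_iff₀ hpos]
  nlinarith

variable (hne : p ≠ q) (hne' : p ≠ -q)

include hne hne'

theorem inner_mem_Ioo : -1 < inner ℝ p q ∧ inner ℝ p q < 1 := by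
  obtain ⟨h1, h2⟩ := inner_mem_Icc hp hq
  refine ⟨lt_of_le_of_ne h1 fun h => hne' ?_, lt_of_le_of_ne h2 fun h => hne ?_⟩
  · exact (inner_eq_neg_one_iff_of_norm_eq_one hp hq).1 h.symm
  · exact (inner_eq_one_iff_of_norm_eq_one hp hq).1 h

theorem sDist_mem_Ioo : 0 < sDist p q ∧ sDist p q < Real.pi := by
  obtain ⟨h1, h2⟩ := inner_mem_Ioo hp hq hne hne'
  refine ⟨Real.arccos_pos.2 h2, lt_of_le_of_ne (Real.arccos_le_pi _) fun h => ?_⟩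
  have := cos_sDist hp hq
  rw [h, Real.cos_pi] at this
  linarith

theorem sin_sDist_pos : 0 < Real.sin (sDist p q) :=
  Real.sin_pos_of_mem_Ioo (sDist_mem_Ioo hp hq hne hne')

theorem norm_sDir : ‖sDir p q‖ = 1 := by
  rw [sDir, norm_smul, norm_inv, norm_norm, norm_tangent hp hq,
    inv_mul_cancel₀ (sin_sDist_pos hp hq hne hne').ne']

theorem eq_cos_smul_add_sin_smul :
    q = Real.cos (sDist p q) • p + Real.sin (sDist p q) • sDir p q := by
  rw [sDir, norm_tangent hp hq, smul_inv_smul₀ (sin_sDist_pos hp hq hne hne').ne',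
    cos_sDist hp hq]
  abel

end SpherePair

theorem sphere_chord_estimates {a p b : R3} (ha : ‖a‖ = 1) (hp : ‖p‖ = 1) (hb : ‖b‖ = 1)
    (hap : a ≠ p ∧ a ≠ -p) (hpb : p ≠ b ∧ p ≠ -b) :
    ‖b - p‖ ≤ 1 * sDist p b ∧ ‖chordDir p b - chordDir a p‖ ≤
      |atan2 (inner ℝ (cross (-sDir p a) (sDir p b)) p) (inner ℝ (-sDir p a) (sDir p b))| +
        1 * (sDist a p + sDist p b) := by
  have hpa : p ≠ a ∧ p ≠ -a := ⟨hap.1.symm, fun h => hap.2 (by rw [h, neg_neg])⟩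
  refine ⟨by rw [one_mul]; exact norm_sub_le_sDist hp hb, ?_⟩
  have h1 := norm_chordDir_sub_sDir_le hp hb hpb.1
  have h2 := norm_chordDir_sub_sDir_le hp ha hpa.1
  have h3 := norm_sub_le_abs_atan2 (u := -sDir p a) (w := sDir p b) (p := p)
    (by rw [norm_neg, norm_sDir hp ha hpa.1 hpa.2]) (norm_sDir hp hb hpb.1 hpb.2) hp
    (by rw [inner_neg_left, real_inner_comm, inner_sDir hp a, neg_zero])
    (by rw [real_inner_comm, inner_sDir hp b])
  have e : chordDir p b - chordDir a p = (chordDir p b - sDir p b) + (chordDir p a - sDir p a) +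
      (sDir p b - -sDir p a) := by
    rw [chordDir_comm p a]; abel
  rw [e, sDist_comm a p]
  linarith [norm_add₃_le (a := chordDir p b - sDir p b) (b := chordDir p a - sDir p a)
    (c := sDir p b - -sDir p a)]

theorem ne_and_ne_neg_of_sDist {p q : R3} (hq : ‖q‖ = 1) (h : 0 < sDist p q)
    (h' : sDist p q < Real.pi) : p ≠ q ∧ p ≠ -q := by
  have hqq : inner ℝ q q = (1 : ℝ) := by rw [real_inner_self_eq_norm_sq, hq, one_pow]
  constructor
  · rintro rfl
    rw [sDist, hqq, Real.arccos_one] at h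
    exact lt_irrefl _ h
  · rintro rfl
    rw [sDist, inner_neg_left, hqq, Real.arccos_neg_one] at h'
    exact lt_irrefl _ h'

/-- The vector with coordinates `a, b, c` in the frame `p, D, p × D`. -/
def frameVec (p D : R3) (a b c : ℝ) : R3 := a • p + b • D + c • cross p D

theorem inner_frameVec {p D : R3} (hp : ‖p‖ = 1) (hD : ‖D‖ = 1) (hpD : inner ℝ p D = 0)
    (a b c a' b' c' : ℝ) : inner ℝ (frameVec p D a b c) (frameVec p D a' b' c') =
      a * a' + b * b' + c * c' := by
  have h1 := inner_cross_self_left p D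
  have h2 := inner_cross_self_right p D
  have h3 := inner_cross_cross p D
  have h4 : inner ℝ D p = 0 := by rw [real_inner_comm, hpD]
  have h5 : inner ℝ (cross p D) p = 0 := by rw [real_inner_comm, h1]
  have h6 : inner ℝ (cross p D) D = 0 := by rw [real_inner_comm, h2]
  have h7 : inner ℝ p p = (1 : ℝ) := by rw [real_inner_self_eq_norm_sq, hp, one_pow]
  have h8 : inner ℝ D D = (1 : ℝ) := by rw [real_inner_self_eq_norm_sq, hD, one_pow]
  rw [h7, h8, hpD] at h3
  simp only [frameVec, inner_add_left, inner_add_right, real_inner_smul_left,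
    real_inner_smul_right, h1, h2, h3, h4, h5, h6, h7, h8, hpD]
  ring

theorem frameVec_sub (p D : R3) (a b c a' b' c' : ℝ) :
    frameVec p D a b c - frameVec p D a' b' c' = frameVec p D (a - a') (b - b') (c - c') := by
  simp only [frameVec, sub_smul]
  abel

theorem norm_frameVec_le {p D : R3} (hp : ‖p‖ = 1) (hD : ‖D‖ = 1) (hpD : inner ℝ p D = 0)
    (a b c : ℝ) : ‖frameVec p D a b c‖ ≤ |a| + |b| + |c| := by
  have h1 := inner_frameVec hp hD hpD a b c a b c
  rw [real_inner_self_eq_norm_sq] at h1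
  refine (sq_le_sq₀ (norm_nonneg _) (by positivity)).1 ?_
  rw [h1, ← abs_mul_abs_self a, ← abs_mul_abs_self b, ← abs_mul_abs_self c]
  nlinarith [mul_nonneg (abs_nonneg a) (abs_nonneg b), mul_nonneg (abs_nonneg a) (abs_nonneg c),
    mul_nonneg (abs_nonneg b) (abs_nonneg c)]

/-- Vertex insertion of the sphere. -/
def sInsert (p q : R3) (α : ℝ) : R3 :=
  Real.cos (sNew p q α) • p +
    Real.sin (sNew p q α) • (Real.cos α • sDir p q + Real.sin α • cross p (sDir p q))

theorem sInsert_eq_frameVec (p q : R3) (α : ℝ) : sInsert p q α = frameVec p (sDir p q)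
    (Real.cos (sNew p q α)) (Real.sin (sNew p q α) * Real.cos α)
    (Real.sin (sNew p q α) * Real.sin α) := by
  rw [sInsert, frameVec, smul_add, smul_smul, smul_smul, add_assoc]

theorem sin_sNew_mul_cos (p q : R3) {α : ℝ} (hα : α ∈ admissibleAngles) :
    Real.sin (sNew p q α) * Real.cos α =
      Real.cos (sNew p q α) * Real.tan (sDist p q / 2) := by
  have h2 := two_thirds_le_cos hα
  have h3 : 0 < Real.cos (sNew p q α) := Real.cos_arctan_pos _
  have h4 : Real.tan (sNew p q α) = Real.tan (sDist p q / 2) / Real.cos α := Real.tan_arctan _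
  rw [Real.tan_eq_sin_div_cos, div_eq_div_iff h3.ne' (by positivity)] at h4
  linarith

section SphereInsert

variable {p q : R3} (hp : ‖p‖ = 1) (hq : ‖q‖ = 1) (hne : p ≠ q) (hne' : p ≠ -q)
  {α : ℝ} (hα : α ∈ admissibleAngles)

include hp hq hne hne'

theorem eq_frameVec :
    q = frameVec p (sDir p q) (Real.cos (sDist p q)) (Real.sin (sDist p q)) 0 := by
  rw [frameVec, zero_smul, add_zero]
  exact eq_cos_smul_add_sin_smul hp hq hne hne'

theorem norm_sInsert (α : ℝ) : ‖sInsert p q α‖ = 1 := by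
  have h1 := inner_frameVec hp (norm_sDir hp hq hne hne') (inner_sDir hp q)
    (Real.cos (sNew p q α)) (Real.sin (sNew p q α) * Real.cos α)
    (Real.sin (sNew p q α) * Real.sin α) (Real.cos (sNew p q α))
    (Real.sin (sNew p q α) * Real.cos α) (Real.sin (sNew p q α) * Real.sin α)
  rw [← sInsert_eq_frameVec, real_inner_self_eq_norm_sq] at h1
  have h2 : ‖sInsert p q α‖ ^ 2 = 1 := by
    rw [h1]
    linear_combination Real.sin_sq_add_cos_sq (sNew p q α) +
      Real.sin (sNew p q α) ^ 2 * Real.sin_sq_add_cos_sq α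
  exact (pow_eq_one_iff_of_nonneg (norm_nonneg _) two_ne_zero).1 h2

theorem tan_half_pos : 0 < Real.tan (sDist p q / 2) := by
  obtain ⟨h1, h2⟩ := sDist_mem_Ioo hp hq hne hne'
  exact Real.tan_pos_of_pos_of_lt_pi_div_two (by linarith) (by linarith)

theorem tan_half_le (h : sDist p q ≤ 1) :
    Real.tan (sDist p q / 2) ≤ sDist p q / 2 * (1 + sDist p q) := by
  obtain ⟨h5, h6⟩ := sDist_mem_Ioo hp hq hne hne'
  have h1 := Real.one_sub_sq_div_two_le_cos (x := sDist p q / 2)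
  have h2 := Real.sin_le (x := sDist p q / 2) (by linarith)
  have h7 : 0 < Real.cos (sDist p q / 2) :=
    Real.cos_pos_of_mem_Ioo ⟨by linarith, by linarith⟩
  rw [Real.tan_eq_sin_div_cos, div_le_iff₀ h7]
  refine h2.trans ?_
  have h3 : 1 ≤ (1 + sDist p q) * Real.cos (sDist p q / 2) := by nlinarith
  nlinarith

include hα

theorem sNew_mem_Ioo : 0 < sNew p q α ∧ sNew p q α < Real.pi / 2 := by
  have h1 := tan_half_pos hp hq hne hne'
  have h2 := two_thirds_le_cos hα
  exact ⟨Real.arctan_pos.2 (by positivity), Real.arctan_lt_pi_div_two _⟩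

theorem sDist_left_sInsert : sDist p (sInsert p q α) = sNew p q α := by
  obtain ⟨h1, h2⟩ := sNew_mem_Ioo hp hq hne hne' hα
  have h3 : inner ℝ p (sInsert p q α) = Real.cos (sNew p q α) := by
    have h4 := inner_frameVec hp (norm_sDir hp hq hne hne') (inner_sDir hp q) 1 0 0
      (Real.cos (sNew p q α)) (Real.sin (sNew p q α) * Real.cos α)
      (Real.sin (sNew p q α) * Real.sin α)
    rw [← sInsert_eq_frameVec] at h4
    simpa [frameVec] using h4
  rw [sDist, h3, Real.arccos_cos h1.le (by linarith [Real.pi_pos])]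

theorem sDist_sInsert_right : sDist (sInsert p q α) q = sNew p q α := by
  obtain ⟨h1, h2⟩ := sNew_mem_Ioo hp hq hne hne' hα
  obtain ⟨h5, h6⟩ := sDist_mem_Ioo hp hq hne hne'
  have h3 : inner ℝ (sInsert p q α) q = Real.cos (sNew p q α) := by
    have h4 := inner_frameVec hp (norm_sDir hp hq hne hne') (inner_sDir hp q)
      (Real.cos (sNew p q α)) (Real.sin (sNew p q α) * Real.cos α)
      (Real.sin (sNew p q α) * Real.sin α) (Real.cos (sDist p q)) (Real.sin (sDist p q)) 0
    rw [← sInsert_eq_frameVec, ← eq_frameVec hp hq hne hne',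
      sin_sNew_mul_cos p q hα] at h4
    have h7 : 0 < Real.cos (sDist p q / 2) :=
      Real.cos_pos_of_mem_Ioo ⟨by linarith, by linarith⟩
    have h8 : Real.tan (sDist p q / 2) * Real.cos (sDist p q / 2) = Real.sin (sDist p q / 2) :=
      Real.tan_mul_cos h7.ne'
    have h9 : Real.cos (sDist p q) = 1 - 2 * Real.sin (sDist p q / 2) ^ 2 := by
      have e := Real.cos_two_mul (sDist p q / 2)
      rw [mul_div_cancel₀ _ (two_ne_zero (α := ℝ))] at e
      linear_combination e + 2 * Real.sin_sq_add_cos_sq (sDist p q / 2)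
    have h10 : Real.sin (sDist p q) = 2 * Real.sin (sDist p q / 2) * Real.cos (sDist p q / 2) := by
      rw [← Real.sin_two_mul]; ring_nf
    rw [h4, h9, h10]
    linear_combination 2 * Real.cos (sNew p q α) * Real.sin (sDist p q / 2) * h8
  rw [sDist, h3, Real.arccos_cos h1.le (by linarith [Real.pi_pos])]

theorem sNew_le (h : sDist p q ≤ 1) :
    sNew p q α ≤ sDist p q / 2 * (1 + 3 * (sDist p q + |Real.sin α|)) := by
  obtain ⟨h1, h2⟩ := sNew_mem_Ioo hp hq hne hne' hα
  obtain ⟨h5, h6⟩ := sDist_mem_Ioo hp hq hne hne'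
  have h3 := Real.le_tan h1.le h2
  have h4 : Real.tan (sNew p q α) = Real.tan (sDist p q / 2) / Real.cos α := Real.tan_arctan _
  have h7 := inv_cos_le hα
  have h8 := tan_half_le hp hq hne hne' h
  have h9 := abs_nonneg (Real.sin α)
  have h10 := two_thirds_le_cos hα
  rw [h4, div_eq_mul_inv] at h3
  calc _ ≤ _ := h3
    _ ≤ (sDist p q / 2 * (1 + sDist p q)) * (1 + 3 / 2 * |Real.sin α|) := by gcongr
    _ ≤ _ := by
      rw [mul_assoc]
      gcongr
      nlinarith

theorem sNew_le_four_mul (h : sDist p q ≤ 1) : sNew p q α ≤ 4 * sDist p q := by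
  have h1 := sNew_le hp hq hne hne' hα h
  obtain ⟨h5, h6⟩ := sDist_mem_Ioo hp hq hne hne'
  have h2 := Real.abs_sin_le_one α
  nlinarith

theorem abs_sin_le_sphere : |Real.sin α| ≤ 10 * (|atan2
    (inner ℝ (cross (-sDir (sInsert p q α) p) (sDir (sInsert p q α) q)) (sInsert p q α))
    (inner ℝ (-sDir (sInsert p q α) p) (sDir (sInsert p q α) q))| + sDist p q) := by
  obtain ⟨hc0, hc1⟩ := sNew_mem_Ioo hp hq hne hne' hα
  have hpi := Real.pi_pos
  have hx := norm_sInsert hp hq hne hne' α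
  have hl := sDist_left_sInsert hp hq hne hne' hα
  have hr := sDist_sInsert_right hp hq hne hne' hα
  have hD := norm_sDir hp hq hne hne'
  have hpD := inner_sDir hp q
  have hpx := ne_and_ne_neg_of_sDist (p := p) hx (by rw [hl]; exact hc0) (by rw [hl]; linarith)
  have hxq := ne_and_ne_neg_of_sDist (p := sInsert p q α) hq (by rw [hr]; exact hc0)
    (by rw [hr]; linarith)
  have hchord := (sphere_chord_estimates hp hx hq hpx hxq).2
  rw [hl, hr] at hchord
  have h1 := norm_sub_le_sDist hp hx
  have h2 := norm_sub_le_sDist hx hq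
  rw [hl] at h1
  rw [hr] at h2
  have h3 : 0 < ‖sInsert p q α - p‖ := norm_pos_iff.2 (sub_ne_zero.2 hpx.1.symm)
  have h4 : 0 < ‖q - sInsert p q α‖ := norm_pos_iff.2 (sub_ne_zero.2 hxq.1.symm)
  have hsin : sNew p q α / 2 ≤ Real.sin (sNew p q α) := by
    refine le_trans ?_ (Real.mul_le_sin hc0.le hc1.le)
    rw [div_mul_eq_mul_div, div_le_div_iff₀ two_pos hpi]
    nlinarith [Real.pi_le_four]
  set n := frameVec p (sDir p q) 0 0 1 with hn
  have hn1 : ‖n‖ = 1 := by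
    have := inner_frameVec hp hD hpD 0 0 1 0 0 1
    rw [← hn, real_inner_self_eq_norm_sq] at this
    exact (pow_eq_one_iff_of_nonneg (norm_nonneg _) two_ne_zero).1 (by rw [this]; norm_num)
  have hnx : inner ℝ n (sInsert p q α) = Real.sin (sNew p q α) * Real.sin α := by
    rw [sInsert_eq_frameVec, hn, inner_frameVec hp hD hpD]; ring
  have hnp : inner ℝ n p = (0 : ℝ) := by
    have := inner_frameVec hp hD hpD 0 0 1 1 0 0
    rw [← hn] at this
    simpa [frameVec] using this
  have hnq : inner ℝ n q = (0 : ℝ) := by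
    have := inner_frameVec hp hD hpD 0 0 1 (Real.cos (sDist p q)) (Real.sin (sDist p q)) 0
    rw [← hn, ← eq_frameVec hp hq hne hne'] at this
    simpa using this
  have h5 : inner ℝ n (chordDir (sInsert p q α) q - chordDir p (sInsert p q α)) =
      -((‖q - sInsert p q α‖⁻¹ + ‖sInsert p q α - p‖⁻¹) *
        (Real.sin (sNew p q α) * Real.sin α)) := by
    rw [chordDir, chordDir, inner_sub_right, real_inner_smul_right, real_inner_smul_right,
      inner_sub_right, inner_sub_right, hnx, hnp, hnq]
    ring
  have h6 := abs_real_inner_le_norm n (chordDir (sInsert p q α) q - chordDir p (sInsert p q α))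
  have hs0 : 0 < Real.sin (sNew p q α) := by linarith
  rw [h5, hn1, one_mul, abs_neg, abs_mul, abs_mul, abs_of_pos hs0, abs_of_pos (by positivity)] at h6
  have h7 : 1 ≤ (‖q - sInsert p q α‖⁻¹ + ‖sInsert p q α - p‖⁻¹) * Real.sin (sNew p q α) := by
    have h8 := inv_anti₀ h3 h1
    have h9 := inv_anti₀ h4 h2
    calc 1 = ((sNew p q α)⁻¹ + (sNew p q α)⁻¹) * (sNew p q α / 2) := by field_simp; norm_num
      _ ≤ _ := by gcongr
  have h8 : |Real.sin α| ≤ ‖chordDir (sInsert p q α) q - chordDir p (sInsert p q α)‖ := by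
    refine le_trans ?_ h6
    rw [← mul_assoc]
    exact le_mul_of_one_le_left (abs_nonneg _) h7
  rcases le_total (sDist p q) 1 with h | h
  · have h9 := sNew_le_four_mul hp hq hne hne' hα h
    linarith [abs_nonneg (atan2
      (inner ℝ (cross (-sDir (sInsert p q α) p) (sDir (sInsert p q α) q)) (sInsert p q α))
      (inner ℝ (-sDir (sInsert p q α) p) (sDir (sInsert p q α) q))),
      (sDist_mem_Ioo hp hq hne hne').1]
  · linarith [Real.abs_sin_le_one α, abs_nonneg (atan2
      (inner ℝ (cross (-sDir (sInsert p q α) p) (sDir (sInsert p q α) q)) (sInsert p q α))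
      (inner ℝ (-sDir (sInsert p q α) p) (sDir (sInsert p q α) q)))]

theorem sDist_sInsert_sInsert_le {β : ℝ} (hβ : β ∈ admissibleAngles) (h : sDist p q ≤ 1) :
    sDist (sInsert p q α) (sInsert p q β) ≤
      100 * sDist p q * (sDist p q + |Real.sin α| + |Real.sin β|) := by
  have hcos : ∀ γ ∈ admissibleAngles, 1 - 8 * sDist p q ^ 2 ≤ Real.cos (sNew p q γ) := by
    intro γ hγ
    have h1 := sNew_le_four_mul hp hq hne hne' hγ h
    have h2 := (sNew_mem_Ioo hp hq hne hne' hγ).1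
    have h3 := Real.one_sub_sq_div_two_le_cos (x := sNew p q γ)
    nlinarith
  have hsin : ∀ γ ∈ admissibleAngles, |Real.sin (sNew p q γ) * Real.sin γ| ≤
      4 * sDist p q * |Real.sin γ| := by
    intro γ hγ
    have h1 := sNew_le_four_mul hp hq hne hne' hγ h
    have h2 := (sNew_mem_Ioo hp hq hne hne' hγ)
    have h3 := Real.sin_le h2.1.le
    have h4 := Real.sin_nonneg_of_nonneg_of_le_pi h2.1.le (by linarith [Real.pi_pos])
    rw [abs_mul, abs_of_nonneg h4]
    gcongr
    linarith
  obtain ⟨he0, _⟩ := sDist_mem_Ioo hp hq hne hne'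
  refine (sDist_le_two_mul_norm_sub (norm_sInsert hp hq hne hne' α)
    (norm_sInsert hp hq hne hne' β)).trans ?_
  rw [sInsert_eq_frameVec p q α, sInsert_eq_frameVec p q β, frameVec_sub]
  have h1 := norm_frameVec_le hp (norm_sDir hp hq hne hne') (inner_sDir hp q)
    (Real.cos (sNew p q β) - Real.cos (sNew p q α))
    (Real.sin (sNew p q β) * Real.cos β - Real.sin (sNew p q α) * Real.cos α)
    (Real.sin (sNew p q β) * Real.sin β - Real.sin (sNew p q α) * Real.sin α)
  have h2 : |Real.cos (sNew p q β) - Real.cos (sNew p q α)| ≤ 8 * sDist p q ^ 2 := by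
    have := hcos α hα
    have := hcos β hβ
    rw [abs_le]
    constructor <;> linarith [Real.cos_le_one (sNew p q α), Real.cos_le_one (sNew p q β)]
  have h3 : |Real.sin (sNew p q β) * Real.cos β - Real.sin (sNew p q α) * Real.cos α| ≤
      8 * sDist p q ^ 2 := by
    have h4 := tan_half_le hp hq hne hne' h
    have h5 := tan_half_pos hp hq hne hne'
    rw [sin_sNew_mul_cos p q hα, sin_sNew_mul_cos p q hβ, ← sub_mul, abs_mul, abs_of_pos h5]
    calc _ ≤ 8 * sDist p q ^ 2 * 1 := by
          gcongr
          nlinarith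
      _ = _ := mul_one _
  have h4 := abs_sub (Real.sin (sNew p q β) * Real.sin β) (Real.sin (sNew p q α) * Real.sin α)
  have h5 := hsin α hα
  have h6 := hsin β hβ
  have h7 := mul_nonneg he0.le (abs_nonneg (Real.sin α))
  have h8 := mul_nonneg he0.le (abs_nonneg (Real.sin β))
  nlinarith [mul_pos he0 he0]

end SphereInsert

theorem hasLocalEstimates_sphere : HasLocalEstimates sphere 100 1 where
  B_nonneg := by norm_num
  η_pos := one_pos
  gdist_self := fun (p : R3) hp => by
    have hp : ‖p‖ = 1 := mem_sphere_zero_iff_norm.1 hp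
    change Real.arccos (inner ℝ p p) = 0
    rw [real_inner_self_eq_norm_sq, hp, one_pow, Real.arccos_one]
  gdist_pos := fun _ hp _ hq h => (sDist_mem_Ioo (mem_sphere_zero_iff_norm.1 hp)
    (mem_sphere_zero_iff_norm.1 hq) h.1 h.2).1
  ne_of_goodEdge := fun _ _ h => h.1
  insertPt_mem := fun _ hp _ hq h α _ => mem_sphere_zero_iff_norm.2
    (norm_sInsert (mem_sphere_zero_iff_norm.1 hp) (mem_sphere_zero_iff_norm.1 hq) h.1 h.2 α)
  gdist_left_le := fun (p : R3) hp (q : R3) hq h α hα he => by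
    have hp : ‖p‖ = 1 := mem_sphere_zero_iff_norm.1 hp
    have hq : ‖q‖ = 1 := mem_sphere_zero_iff_norm.1 hq
    have h1 := sNew_le hp hq h.1 h.2 hα he
    change sDist p (sInsert p q α) ≤ sDist p q / 2 * (1 + 100 * (sDist p q + |Real.sin α|))
    rw [sDist_left_sInsert hp hq h.1 h.2 hα]
    have h2 := (sDist_mem_Ioo hp hq h.1 h.2).1
    refine h1.trans ?_
    gcongr
    norm_num
  gdist_right_le := fun (p : R3) hp (q : R3) hq h α hα he => by
    have hp : ‖p‖ = 1 := mem_sphere_zero_iff_norm.1 hp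
    have hq : ‖q‖ = 1 := mem_sphere_zero_iff_norm.1 hq
    have h1 := sNew_le hp hq h.1 h.2 hα he
    change sDist (sInsert p q α) q ≤ sDist p q / 2 * (1 + 100 * (sDist p q + |Real.sin α|))
    rw [sDist_sInsert_right hp hq h.1 h.2 hα]
    have h2 := (sDist_mem_Ioo hp hq h.1 h.2).1
    refine h1.trans ?_
    gcongr
    norm_num
  abs_sin_le := fun (p : R3) hp (q : R3) hq h α hα => by
    have hp : ‖p‖ = 1 := mem_sphere_zero_iff_norm.1 hp
    have hq : ‖q‖ = 1 := mem_sphere_zero_iff_norm.1 hq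
    have h1 := abs_sin_le_sphere hp hq h.1 h.2 hα
    have h2 := (sDist_mem_Ioo hp hq h.1 h.2).1
    refine h1.trans (mul_le_mul_of_nonneg_right (by norm_num) ?_)
    exact add_nonneg (abs_nonneg _) h2.le
  gdist_insertPt_le := fun _ hp _ hq h _ hα _ hβ he =>
    sDist_sInsert_sInsert_le (mem_sphere_zero_iff_norm.1 hp) (mem_sphere_zero_iff_norm.1 hq)
      h.1 h.2 hα hβ he
  exists_closed := fun _ _ _ _ _ _ hP _ =>
    ⟨Metric.sphere (0 : R3) 1, 1, zero_le_one, Metric.isClosed_sphere, subset_rfl, hP,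
      fun _ ha _ hp _ hb hap hpb => sphere_chord_estimates (mem_sphere_zero_iff_norm.1 ha)
        (mem_sphere_zero_iff_norm.1 hp) (mem_sphere_zero_iff_norm.1 hb) hap hpb⟩

/-! ### Elementary estimates for `artanh` -/

theorem artanh_le_div {y : ℝ} (h0 : 0 ≤ y) (h1 : y < 1) : Real.artanh y ≤ y / (1 - y) := by
  have h2 : 0 < 1 - y := by linarith
  rw [Real.artanh_eq_half_log ⟨by linarith, h1.le⟩]
  have h3 := Real.log_le_sub_one_of_pos (by positivity : 0 < (1 + y) / (1 - y))
  have h4 : (1 + y) / (1 - y) - 1 = 2 * (y / (1 - y)) := by field_simp; ring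
  linarith

theorem artanh_le_two_mul {y : ℝ} (h0 : 0 ≤ y) (h1 : y ≤ 1 / 2) : Real.artanh y ≤ 2 * y := by
  refine (artanh_le_div h0 (by linarith)).trans ?_
  rw [div_le_iff₀ (by linarith)]
  nlinarith

theorem le_artanh {y : ℝ} (h0 : 0 ≤ y) (h1 : y < 1) : y ≤ Real.artanh y := by
  have h2 : 0 < 1 - y := by linarith
  rw [Real.artanh_eq_half_log ⟨by linarith, h1.le⟩]
  have h3 := Real.le_log_one_add_of_nonneg (by positivity : 0 ≤ 2 * y / (1 - y))
  have h4 : 1 + 2 * y / (1 - y) = (1 + y) / (1 - y) := by field_simp; ring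
  have h5 : 2 * (2 * y / (1 - y)) / (2 * y / (1 - y) + 2) = 2 * y := by field_simp; ring
  rw [h4, h5] at h3
  linarith

theorem exp_neg_two_mul_artanh {y : ℝ} (h0 : 0 ≤ y) (h1 : y < 1) :
    Real.exp (-(2 * Real.artanh y)) = (1 - y) / (1 + y) := by
  have h2 : 0 < 1 - y := by linarith
  rw [Real.artanh_eq_half_log ⟨by linarith, h1.le⟩, ← mul_assoc, mul_one_div_cancel two_ne_zero,
    one_mul, Real.exp_neg, Real.exp_log (by positivity), inv_div]

/-! ### The hyperbolic plane -/

theorem mobiusAdd_neg (z w : ℂ) : mobiusAdd (-z) w = (w - z) / (1 - conj z * w) := by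
  rw [mobiusAdd, map_neg, neg_mul, ← sub_eq_add_neg, neg_add_eq_sub]

theorem one_add_conj_mul_ne_zero {z w : ℂ} (hz : ‖z‖ < 1) (hw : ‖w‖ < 1) :
    1 + conj z * w ≠ 0 := by
  intro h
  have h1 : ‖conj z * w‖ = 1 := by
    rw [← neg_eq_iff_add_eq_zero.2 h, norm_neg, norm_one]
  rw [norm_mul, Complex.norm_conj] at h1
  nlinarith [norm_nonneg z, norm_nonneg w]

theorem one_sub_conj_mul_ne_zero {z w : ℂ} (hz : ‖z‖ < 1) (hw : ‖w‖ < 1) :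
    1 - conj z * w ≠ 0 := by
  have := one_add_conj_mul_ne_zero (z := -z) (by rwa [norm_neg]) hw
  rwa [map_neg, neg_mul, ← sub_eq_add_neg] at this

theorem one_sub_norm_mobiusAdd_sq {z w : ℂ} (hz : ‖z‖ < 1) (hw : ‖w‖ < 1) :
    1 - ‖mobiusAdd z w‖ ^ 2 = (1 - ‖z‖ ^ 2) * (1 - ‖w‖ ^ 2) / ‖1 + conj z * w‖ ^ 2 := by
  have h1 : 0 < ‖1 + conj z * w‖ := norm_pos_iff.2 (one_add_conj_mul_ne_zero hz hw)
  rw [mobiusAdd, norm_div, div_pow, eq_div_iff (by positivity), sub_mul,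
    div_mul_cancel₀ _ (by positivity)]
  simp only [Complex.sq_norm, Complex.normSq_apply]
  simp
  ring

theorem norm_mobiusAdd_lt_one {z w : ℂ} (hz : ‖z‖ < 1) (hw : ‖w‖ < 1) : ‖mobiusAdd z w‖ < 1 := by
  have h1 : 0 < ‖1 + conj z * w‖ := norm_pos_iff.2 (one_add_conj_mul_ne_zero hz hw)
  have h2 := one_sub_norm_mobiusAdd_sq hz hw
  have h3 : 0 < 1 - ‖z‖ ^ 2 := by nlinarith [norm_nonneg z]
  have h4 : 0 < 1 - ‖w‖ ^ 2 := by nlinarith [norm_nonneg w]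
  have h5 : 0 < 1 - ‖mobiusAdd z w‖ ^ 2 := by rw [h2]; positivity
  nlinarith [norm_nonneg (mobiusAdd z w)]

theorem mobiusAdd_zero (z : ℂ) : mobiusAdd z 0 = z := by simp [mobiusAdd]

/-- Left translations preserve the relative position of points up to a rotation. -/
theorem mobiusAdd_neg_mobiusAdd {z w x : ℂ} (hz : ‖z‖ < 1) (hw : ‖w‖ < 1) (hx : ‖x‖ < 1) :
    mobiusAdd (-mobiusAdd z w) (mobiusAdd z x) =
      (1 + conj w * z) / (1 + conj z * w) * mobiusAdd (-w) x := by
  have h1 := one_add_conj_mul_ne_zero hz hw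
  have h2 := one_add_conj_mul_ne_zero hz hx
  have h3 := one_sub_conj_mul_ne_zero hw hx
  have h4 := one_add_conj_mul_ne_zero hw hz
  have h5 := one_sub_conj_mul_ne_zero hz hz
  have e1 : mobiusAdd z x - mobiusAdd z w =
      (x - w) * (1 - conj z * z) / ((1 + conj z * x) * (1 + conj z * w)) := by
    rw [mobiusAdd, mobiusAdd, div_sub_div _ _ h2 h1]
    congr 1
    ring
  have e2 : 1 - conj (mobiusAdd z w) * mobiusAdd z x =
      (1 - conj w * x) * (1 - conj z * z) / ((1 + conj w * z) * (1 + conj z * x)) := by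
    have h6 : conj (mobiusAdd z w) = (conj z + conj w) / (1 + conj w * z) := by
      rw [mobiusAdd, map_div₀, map_add, map_add, map_mul, map_one, Complex.conj_conj, mul_comm z]
    rw [h6, mobiusAdd, div_mul_div_comm, eq_div_iff (mul_ne_zero h4 h2), sub_mul,
      div_mul_cancel₀ _ (mul_ne_zero h4 h2)]
    ring
  rw [mobiusAdd_neg, mobiusAdd_neg, e1, e2, div_div_div_eq, div_mul_div_comm, div_eq_div_iff
    (mul_ne_zero (mul_ne_zero h2 h1) (mul_ne_zero h3 h5)) (mul_ne_zero h1 h3)]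
  ring

theorem norm_gyration {z w : ℂ} (hz : ‖z‖ < 1) (hw : ‖w‖ < 1) :
    ‖(1 + conj w * z) / (1 + conj z * w)‖ = 1 := by
  have h1 : 1 + conj w * z = conj (1 + conj z * w) := by
    rw [map_add, map_mul, map_one, Complex.conj_conj, mul_comm]
  rw [norm_div, h1, Complex.norm_conj, div_self]
  exact norm_ne_zero_iff.2 (one_add_conj_mul_ne_zero hz hw)

theorem mobiusAdd_neg_cancel {z w : ℂ} (hz : ‖z‖ < 1) (hw : ‖w‖ < 1) :
    mobiusAdd (-z) (mobiusAdd z w) = w := by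
  have h0 : ‖(0 : ℂ)‖ < 1 := by simp
  have := mobiusAdd_neg_mobiusAdd hz h0 hw
  simpa [mobiusAdd] using this

theorem mobiusAdd_cancel {z w : ℂ} (hz : ‖z‖ < 1) (hw : ‖w‖ < 1) :
    mobiusAdd z (mobiusAdd (-z) w) = w := by
  have := mobiusAdd_neg_cancel (z := -z) (by rwa [norm_neg]) hw
  rwa [neg_neg] at this

theorem norm_mobiusAdd_neg_comm (z w : ℂ) : ‖mobiusAdd (-z) w‖ = ‖mobiusAdd (-w) z‖ := by
  have h : 1 - conj w * z = conj (1 - conj z * w) := by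
    rw [map_sub, map_mul, map_one, Complex.conj_conj, mul_comm]
  rw [mobiusAdd_neg, mobiusAdd_neg, norm_div, norm_div, h, Complex.norm_conj, norm_sub_rev]

theorem hDist_comm (z w : ℂ) : hDist z w = hDist w z := by
  rw [hDist, hDist, norm_mobiusAdd_neg_comm]

section HyperbolicPair

variable {p q : ℂ} (hp : ‖p‖ < 1) (hq : ‖q‖ < 1)

include hp hq

theorem norm_mobiusAdd_neg_lt_one : ‖mobiusAdd (-p) q‖ < 1 :=
  norm_mobiusAdd_lt_one (by rwa [norm_neg]) hq

theorem tanh_half_hDist : Real.tanh (hDist p q / 2) = ‖mobiusAdd (-p) q‖ := by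
  rw [hDist, mul_div_cancel_left₀ _ (two_ne_zero (α := ℝ)), Real.tanh_artanh]
  exact ⟨by linarith [norm_nonneg (mobiusAdd (-p) q)], norm_mobiusAdd_neg_lt_one hp hq⟩

theorem two_mul_norm_mobiusAdd_le_hDist : 2 * ‖mobiusAdd (-p) q‖ ≤ hDist p q := by
  have := le_artanh (norm_nonneg _) (norm_mobiusAdd_neg_lt_one hp hq)
  rw [hDist]
  linarith

theorem sub_eq_mobiusAdd_mul : q - p = mobiusAdd (-p) q * (1 - conj p * q) := by
  rw [mobiusAdd_neg, div_mul_cancel₀ _ (one_sub_conj_mul_ne_zero hp hq)]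

theorem norm_sub_le_hDist : ‖q - p‖ ≤ hDist p q := by
  refine le_trans ?_ (two_mul_norm_mobiusAdd_le_hDist hp hq)
  rw [sub_eq_mobiusAdd_mul hp hq, norm_mul, mul_comm]
  gcongr
  refine (norm_sub_le _ _).trans ?_
  rw [norm_one, norm_mul, Complex.norm_conj]
  nlinarith [norm_nonneg p, norm_nonneg q]

theorem chordDir_eq_hDir_mul : chordDir p q =
    hDir p q * (‖1 - conj p * q‖⁻¹ • (1 - conj p * q)) := by
  rw [chordDir, sub_eq_mobiusAdd_mul hp hq, hDir, norm_mul, Complex.real_smul, Complex.real_smul]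
  push_cast
  rw [mul_inv]
  ring

theorem one_sub_norm_mobiusAdd_sq_ge :
    (1 - ‖p‖ ^ 2) * Real.exp (-hDist p q) ≤ 1 - ‖q‖ ^ 2 := by
  set w := mobiusAdd (-p) q with hw
  have hw1 : ‖w‖ < 1 := norm_mobiusAdd_neg_lt_one hp hq
  have h1 : q = mobiusAdd p w := (mobiusAdd_cancel hp hq).symm
  have h2 := one_sub_norm_mobiusAdd_sq hp hw1
  have h3 : 0 < ‖1 + conj p * w‖ := norm_pos_iff.2 (one_add_conj_mul_ne_zero hp hw1)
  have h4 : ‖1 + conj p * w‖ ≤ 1 + ‖w‖ := by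
    refine (norm_add_le _ _).trans ?_
    rw [norm_one, norm_mul, Complex.norm_conj]
    nlinarith [norm_nonneg p, norm_nonneg w]
  have h5 : 0 < 1 - ‖p‖ ^ 2 := by nlinarith [norm_nonneg p]
  have h6 : 0 < 1 - ‖w‖ ^ 2 := by nlinarith [norm_nonneg w]
  rw [← h1] at h2
  rw [h2, hDist, ← hw, exp_neg_two_mul_artanh (norm_nonneg _) hw1]
  have h7 := norm_nonneg w
  calc (1 - ‖p‖ ^ 2) * ((1 - ‖w‖) / (1 + ‖w‖)) =
      (1 - ‖p‖ ^ 2) * (1 - ‖w‖ ^ 2) / (1 + ‖w‖) ^ 2 := by field_simp; ring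
    _ ≤ _ := by gcongr

variable (hne : p ≠ q)

include hne

theorem norm_mobiusAdd_neg_pos : 0 < ‖mobiusAdd (-p) q‖ := by
  rw [norm_pos_iff, mobiusAdd_neg]
  exact div_ne_zero (sub_ne_zero.2 hne.symm) (one_sub_conj_mul_ne_zero hp hq)

theorem norm_hDir : ‖hDir p q‖ = 1 := by
  have h := norm_mobiusAdd_neg_pos hp hq hne
  rw [hDir, norm_div, Complex.norm_real, norm_norm, div_self h.ne']

theorem norm_chordDir_sub_hDir_le :
    ‖chordDir p q - hDir p q‖ ≤ 2 / (1 - ‖p‖ ^ 2) * hDist p q := by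
  have h5 : 0 < 1 - ‖p‖ ^ 2 := by nlinarith [norm_nonneg p]
  have h1 := norm_inv_smul_sub_le (v := 1 - conj p * p) (w := 1 - conj p * q)
    (one_sub_conj_mul_ne_zero hp hp)
  have h2 : 1 - conj p * p = ((1 - ‖p‖ ^ 2 : ℝ) : ℂ) := by
    rw [mul_comm, Complex.mul_conj, Complex.normSq_eq_norm_sq]; push_cast; ring
  have h3 : ‖1 - conj p * p - (1 - conj p * q)‖ ≤ hDist p q := by
    have : 1 - conj p * p - (1 - conj p * q) = conj p * (q - p) := by ring
    rw [this, norm_mul, Complex.norm_conj]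
    have := norm_sub_le_hDist hp hq
    nlinarith [norm_nonneg p, norm_nonneg (q - p)]
  have h4 : ‖(1 : ℂ) - conj p * p‖⁻¹ • ((1 : ℂ) - conj p * p) = 1 := by
    rw [h2, Complex.norm_real, Real.norm_of_nonneg h5.le, Complex.real_smul, ← Complex.ofReal_mul,
      inv_mul_cancel₀ h5.ne', Complex.ofReal_one]
  have h6 : ‖(1 : ℂ) - conj p * p‖ = 1 - ‖p‖ ^ 2 := by
    rw [h2, Complex.norm_real, Real.norm_of_nonneg h5.le]
  rw [h4, h6] at h1
  have h7 : chordDir p q - hDir p q =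
      -(hDir p q * (1 - ‖1 - conj p * q‖⁻¹ • (1 - conj p * q))) := by
    rw [chordDir_eq_hDir_mul hp hq]; ring
  rw [h7, norm_neg, norm_mul, norm_hDir hp hq hne, one_mul, div_mul_eq_mul_div]
  refine h1.trans ?_
  gcongr

end HyperbolicPair

theorem hyperbolic_chord_estimates {m : ℝ} (hm : 0 < m) {a p b : ℂ} (ha : ‖a‖ < 1)
    (hp : m ≤ 1 - ‖p‖ ^ 2) (hb : ‖b‖ < 1) (hap : a ≠ p) (hpb : p ≠ b) :
    ‖b - p‖ ≤ (1 + 2 / m) * hDist p b ∧ ‖chordDir p b - chordDir a p‖ ≤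
      |planeAngle (-hDir p a) (hDir p b)| + (1 + 2 / m) * (hDist a p + hDist p b) := by
  have hp1 : ‖p‖ < 1 := by nlinarith [norm_nonneg p]
  have h0 := (norm_nonneg _).trans (norm_sub_le_hDist hp1 hb)
  have h0' := (norm_nonneg _).trans (norm_sub_le_hDist hp1 ha)
  have hA : 2 / (1 - ‖p‖ ^ 2) ≤ 1 + 2 / m := by
    have : 2 / (1 - ‖p‖ ^ 2) ≤ 2 / m := by gcongr
    linarith
  have hA1 : 1 ≤ 1 + 2 / m := le_add_of_nonneg_right (by positivity)
  refine ⟨(norm_sub_le_hDist hp1 hb).trans (le_mul_of_one_le_left h0 hA1), ?_⟩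
  have h1 := (norm_chordDir_sub_hDir_le hp1 hb hpb).trans (mul_le_mul_of_nonneg_right hA h0)
  have h2 := (norm_chordDir_sub_hDir_le hp1 ha hap.symm).trans (mul_le_mul_of_nonneg_right hA h0')
  have h3 := norm_sub_le_abs_planeAngle (v := -hDir p a) (w := hDir p b)
    (by rw [norm_neg, norm_hDir hp1 ha hap.symm]) (norm_hDir hp1 hb hpb)
  have e : chordDir p b - chordDir a p = (chordDir p b - hDir p b) + (chordDir p a - hDir p a) +
      (hDir p b - -hDir p a) := by
    rw [chordDir_comm p a]; abel
  rw [e, hDist_comm a p]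
  linarith [norm_add₃_le (a := chordDir p b - hDir p b) (b := chordDir p a - hDir p a)
    (c := hDir p b - -hDir p a)]

theorem exists_hyperbolic_margin {N : ℕ} {P : ℕ → ℤ → ℂ} {C : ℝ} (hN : 0 < N)
    (hper : ∀ j, P 0 (j + N) = P 0 j) (heven : ∀ k j, P (k + 1) (2 * j) = P k j)
    (hP : ∀ k j, ‖P k j‖ < 1)
    (hC : ∀ k j, hDist (P (k + 1) (2 * j)) (P (k + 1) (2 * j + 1)) ≤ C * (1 / 2) ^ k) :
    ∃ m, 0 < m ∧ ∀ k j, m ≤ 1 - ‖P k j‖ ^ 2 := by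
  have hpos : ∀ k j, 0 < 1 - ‖P k j‖ ^ 2 := fun k j => by
    nlinarith [norm_nonneg (P k j), hP k j]
  obtain ⟨c, hc⟩ := exists_forall_le_of_periodic (g := fun j => (1 - ‖P 0 j‖ ^ 2)⁻¹) hN
    fun j => by rw [hper]
  have hc0 : 0 < c := (inv_pos.2 (hpos 0 0)).trans_le (hc 0)
  have hC0 : 0 ≤ C := by
    have h1 := (norm_nonneg _).trans (norm_sub_le_hDist (hP 1 (2 * 0)) (hP 1 (2 * 0 + 1)))
    simpa using h1.trans (hC 0 0)
  have key : ∀ k j, c⁻¹ * Real.exp (-(C * ∑ i ∈ Finset.range k, (1 / 2 : ℝ) ^ i)) ≤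
      1 - ‖P k j‖ ^ 2 := by
    intro k
    induction k with
    | zero =>
      intro j
      simpa using inv_le_of_inv_le₀ (hpos 0 j) (hc j)
    | succ k ih =>
      intro j
      have h1 : c⁻¹ * Real.exp (-(C * ∑ i ∈ Finset.range (k + 1), (1 / 2 : ℝ) ^ i)) =
          c⁻¹ * Real.exp (-(C * ∑ i ∈ Finset.range k, (1 / 2 : ℝ) ^ i)) *
            Real.exp (-(C * (1 / 2) ^ k)) := by
        rw [mul_assoc, ← Real.exp_add, Finset.sum_range_succ]
        ring_nf
      rw [h1]
      rcases Int.even_or_odd' j with ⟨i, rfl | rfl⟩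
      · rw [heven]
        refine le_trans (mul_le_of_le_one_right (by positivity) ?_) (ih i)
        rw [Real.exp_le_one_iff, neg_nonpos]
        positivity
      · refine le_trans ?_ (one_sub_norm_mobiusAdd_sq_ge (hP (k + 1) (2 * i))
          (hP (k + 1) (2 * i + 1)))
        have h2 := hpos (k + 1) (2 * i)
        have h3 := ih i
        rw [← heven] at h3
        have h4 := hC k i
        gcongr
  refine ⟨c⁻¹ * Real.exp (-(C * 2)), by positivity, fun k j => le_trans ?_ (key k j)⟩
  have h5 : ∑ i ∈ Finset.range k, (1 / 2 : ℝ) ^ i ≤ 2 := sum_geometric_two_le k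
  gcongr

/-- Position of the inserted vertex relative to the first endpoint of the edge. -/
def hOffset (p q : ℂ) (α : ℝ) : ℂ := (Real.tanh (hNew p q α / 2) : ℂ) * rot α (hDir p q)

/-- Vertex insertion of the hyperbolic plane. -/
def hInsert (p q : ℂ) (α : ℝ) : ℂ := mobiusAdd p (hOffset p q α)

theorem cos_alphaMax_le {α : ℝ} (hα : α ∈ admissibleAngles) : Real.cos alphaMax ≤ Real.cos α := by
  rw [← Real.cos_abs α]
  refine Real.cos_le_cos_of_nonneg_of_le_pi (abs_nonneg α) ?_ (abs_le.2 hα)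
  unfold alphaMax
  linarith [Real.pi_pos]

theorem tanh_eq_half_angle (x : ℝ) :
    Real.tanh x * (1 + Real.tanh (x / 2) ^ 2) = 2 * Real.tanh (x / 2) := by
  have h1 := Real.cosh_pos (x / 2)
  have h2 := Real.cosh_pos x
  have h3 := Real.sinh_two_mul (x / 2)
  have h4 := Real.cosh_two_mul (x / 2)
  rw [mul_div_cancel₀ _ (two_ne_zero (α := ℝ))] at h3 h4
  rw [Real.tanh_eq_sinh_div_cosh, Real.tanh_eq_sinh_div_cosh, h3, h4]
  have h5 : Real.cosh (x / 2) ^ 2 + Real.sinh (x / 2) ^ 2 ≠ 0 := by positivity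
  field_simp

section HyperbolicInsert

variable {p q : ℂ} (hp : ‖p‖ < 1) (hq : ‖q‖ < 1) (hne : p ≠ q)
  (hgood : Real.tanh (hDist p q / 2) < Real.cos alphaMax) {α : ℝ} (hα : α ∈ admissibleAngles)

include hp hq hne

theorem mobiusAdd_neg_eq_smul : mobiusAdd (-p) q = (‖mobiusAdd (-p) q‖ : ℂ) * hDir p q := by
  have h : (‖mobiusAdd (-p) q‖ : ℂ) ≠ 0 := by
    exact_mod_cast (norm_mobiusAdd_neg_pos hp hq hne).ne'
  rw [hDir, mul_div_cancel₀ _ h]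

theorem norm_hOffset_eq (α : ℝ) : ‖hOffset p q α‖ = |Real.tanh (hNew p q α / 2)| := by
  rw [hOffset, norm_mul, norm_rot, norm_hDir hp hq hne, mul_one, Complex.norm_real,
    Real.norm_eq_abs]

theorem norm_hOffset_lt_one (α : ℝ) : ‖hOffset p q α‖ < 1 := by
  rw [norm_hOffset_eq hp hq hne, abs_lt]
  exact ⟨Real.neg_one_lt_tanh _, Real.tanh_lt_one _⟩

theorem norm_hInsert_lt_one (α : ℝ) : ‖hInsert p q α‖ < 1 :=
  norm_mobiusAdd_lt_one hp (norm_hOffset_lt_one hp hq hne α)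

theorem mobiusAdd_neg_hInsert_right (α : ℝ) : mobiusAdd (-hInsert p q α) q =
    (1 + conj (hOffset p q α) * p) / (1 + conj p * hOffset p q α) *
      mobiusAdd (-hOffset p q α) (mobiusAdd (-p) q) := by
  rw [← mobiusAdd_neg_mobiusAdd hp (norm_hOffset_lt_one hp hq hne α)
    (norm_mobiusAdd_neg_lt_one hp hq), mobiusAdd_cancel hp hq, hInsert]

theorem mobiusAdd_neg_hInsert_left (α : ℝ) : mobiusAdd (-hInsert p q α) p =
    (1 + conj (hOffset p q α) * p) / (1 + conj p * hOffset p q α) * -hOffset p q α := by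
  have h0 : ‖(0 : ℂ)‖ < 1 := by simp
  have := mobiusAdd_neg_mobiusAdd hp (norm_hOffset_lt_one hp hq hne α) h0
  rwa [mobiusAdd_zero, mobiusAdd_zero] at this

include hgood hα

theorem ratio_mem_Ioo : 0 < Real.tanh (hDist p q / 2) / Real.cos α ∧
    Real.tanh (hDist p q / 2) / Real.cos α < 1 := by
  have h1 := two_thirds_le_cos hα
  have h2 := norm_mobiusAdd_neg_pos hp hq hne
  rw [← tanh_half_hDist hp hq] at h2
  exact ⟨by positivity, by
    rw [div_lt_one (by linarith)]; exact hgood.trans_le (cos_alphaMax_le hα)⟩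

theorem hNew_pos : 0 < hNew p q α := Real.artanh_pos (ratio_mem_Ioo hp hq hne hgood hα)

theorem tanh_half_hNew_pos : 0 < Real.tanh (hNew p q α / 2) := by
  have := hNew_pos hp hq hne hgood hα
  rw [Real.tanh_eq_sinh_div_cosh]
  exact div_pos (Real.sinh_pos_iff.2 (by linarith)) (Real.cosh_pos _)

theorem norm_hOffset : ‖hOffset p q α‖ = Real.tanh (hNew p q α / 2) := by
  rw [norm_hOffset_eq hp hq hne, abs_of_pos (tanh_half_hNew_pos hp hq hne hgood hα)]

theorem tanh_half_hNew_mul_cos : 2 * (Real.tanh (hNew p q α / 2) * Real.cos α) =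
    (1 + Real.tanh (hNew p q α / 2) ^ 2) * ‖mobiusAdd (-p) q‖ := by
  have h1 := two_thirds_le_cos hα
  obtain ⟨h2, h3⟩ := ratio_mem_Ioo hp hq hne hgood hα
  have h4 := tanh_eq_half_angle (hNew p q α)
  have h5 : Real.tanh (hNew p q α) = Real.tanh (hDist p q / 2) / Real.cos α :=
    Real.tanh_artanh ⟨by linarith, h3⟩
  rw [h5, tanh_half_hDist hp hq] at h4
  rw [← mul_assoc, ← h4]
  field_simp

theorem norm_mobiusAdd_neg_hOffset :
    ‖mobiusAdd (-hOffset p q α) (mobiusAdd (-p) q)‖ = Real.tanh (hNew p q α / 2) := by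
  have h1 := tanh_half_hNew_mul_cos hp hq hne hgood hα
  have h2 := tanh_half_hNew_pos hp hq hne hgood hα
  have h3 := one_sub_conj_mul_ne_zero (norm_hOffset_lt_one hp hq hne α)
    (norm_mobiusAdd_neg_lt_one hp hq)
  have hD := norm_hDir hp hq hne
  have hDD : conj (hDir p q) * hDir p q = 1 := by
    rw [mul_comm, Complex.mul_conj, Complex.normSq_eq_norm_sq, hD]; simp
  rw [mobiusAdd_neg, norm_div, div_eq_iff (norm_ne_zero_iff.2 h3)]
  set τ := Real.tanh (hNew p q α / 2) with hτ
  set t := ‖mobiusAdd (-p) q‖ with ht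
  have e1 : mobiusAdd (-p) q - hOffset p q α =
      (⟨t - τ * Real.cos α, -(τ * Real.sin α)⟩ : ℂ) * hDir p q := by
    rw [mobiusAdd_neg_eq_smul hp hq hne, hOffset, rot_eq, ← hτ, ← ht, Complex.mk_eq_add_mul_I]
    push_cast
    ring
  have e2 : 1 - conj (hOffset p q α) * mobiusAdd (-p) q =
      (⟨1 - t * τ * Real.cos α, t * τ * Real.sin α⟩ : ℂ) := by
    rw [mobiusAdd_neg_eq_smul hp hq hne, hOffset, rot_eq, ← hτ, ← ht, Complex.mk_eq_add_mul_I]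
    simp only [map_mul, map_add, Complex.conj_ofReal, Complex.conj_I]
    push_cast
    linear_combination -(t * τ * (Complex.cos α - Complex.sin α * Complex.I)) * hDD
  rw [e1, e2, norm_mul, hD, mul_one]
  refine (sq_eq_sq₀ (norm_nonneg _) (by positivity)).1 ?_
  rw [mul_pow, Complex.sq_norm, Complex.sq_norm, Complex.normSq_mk, Complex.normSq_mk]
  have h4 := Real.sin_sq_add_cos_sq α
  linear_combination (-t * (1 - τ ^ 2)) * h1 + (τ ^ 2 - t ^ 2 * τ ^ 4) * h4

theorem hDist_left_hInsert : hDist p (hInsert p q α) = hNew p q α := by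
  rw [hDist, hInsert, mobiusAdd_neg_cancel hp (norm_hOffset_lt_one hp hq hne α),
    norm_hOffset hp hq hne hgood hα, Real.artanh_tanh]
  ring

theorem hDist_hInsert_right : hDist (hInsert p q α) q = hNew p q α := by
  rw [hDist, mobiusAdd_neg_hInsert_right hp hq hne α, norm_mul,
    norm_gyration hp (norm_hOffset_lt_one hp hq hne α), one_mul,
    norm_mobiusAdd_neg_hOffset hp hq hne hgood hα, Real.artanh_tanh]
  ring

theorem abs_sin_le_hyperbolic : |Real.sin α| ≤
    |planeAngle (-hDir (hInsert p q α) p) (hDir (hInsert p q α) q)| + hDist p q := by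
  have hw1 := norm_hOffset_lt_one hp hq hne α
  have hb1 := norm_mobiusAdd_neg_lt_one hp hq
  have hτ := tanh_half_hNew_pos hp hq hne hgood hα
  have hD := norm_hDir hp hq hne
  have hu := norm_gyration hp hw1
  have hτC : (Real.tanh (hNew p q α / 2) : ℂ) ≠ 0 := by exact_mod_cast hτ.ne'
  set w := hOffset p q α with hw
  set b := mobiusAdd (-p) q with hb
  set u := (1 + conj w * p) / (1 + conj p * w) with hudef
  have hwb : w ≠ b := by
    rintro h
    have := norm_mobiusAdd_neg_hOffset hp hq hne hgood hα
    rw [← hw, ← hb, ← h, mobiusAdd_neg, sub_self, zero_div, norm_zero] at this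
    exact hτ.ne this
  have e1 : -hDir (hInsert p q α) p = u * rot α (hDir p q) := by
    rw [hDir, mobiusAdd_neg_hInsert_left hp hq hne α, norm_mul, ← hw, ← hudef, hu, one_mul,
      norm_neg, norm_hOffset hp hq hne hgood hα, hw, hOffset]
    field_simp
  have e2 : hDir (hInsert p q α) q = u * hDir w b := by
    rw [hDir, mobiusAdd_neg_hInsert_right hp hq hne α, norm_mul, ← hw, ← hb, ← hudef, hu,
      one_mul, mul_div_assoc, hDir]
  have h1 := norm_sub_le_abs_planeAngle (v := -hDir (hInsert p q α) p)
    (w := hDir (hInsert p q α) q) (by rw [e1, norm_mul, hu, norm_rot, hD, one_mul])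
    (by rw [e2, norm_mul, hu, norm_hDir hw1 hb1 hwb, one_mul])
  have h2 : ‖hDir w b - rot α (hDir p q)‖ ≤
      |planeAngle (-hDir (hInsert p q α) p) (hDir (hInsert p q α) q)| := by
    refine le_trans (le_of_eq ?_) h1
    rw [e1, e2, ← mul_sub, norm_mul, hu, one_mul]
  have h3 : ‖chordDir w b - hDir w b‖ ≤ hDist p q := by
    have h4 := norm_inv_smul_sub_le (v := (1 : ℂ)) (w := 1 - conj w * b) one_ne_zero
    rw [norm_one, inv_one, one_smul, sub_sub_cancel, div_one] at h4
    have h5 : chordDir w b - hDir w b =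
        -(hDir w b * (1 - ‖1 - conj w * b‖⁻¹ • (1 - conj w * b))) := by
      rw [chordDir_eq_hDir_mul hw1 hb1]; ring
    rw [h5, norm_neg, norm_mul, norm_hDir hw1 hb1 hwb, one_mul]
    refine h4.trans (le_trans ?_ (two_mul_norm_mobiusAdd_le_hDist hp hq))
    rw [norm_mul, Complex.norm_conj]
    nlinarith [norm_nonneg w, norm_nonneg b]
  have h4 : |Real.sin α| ≤ ‖chordDir w b - rot α (hDir p q)‖ := by
    have hDD : conj (hDir p q) * hDir p q = 1 := by
      rw [mul_comm, Complex.mul_conj, Complex.normSq_eq_norm_sq, hD]; simp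
    have h5 : conj (hDir p q) * (chordDir w b - rot α (hDir p q)) =
        ((‖b - w‖⁻¹ * (‖b‖ - Real.tanh (hNew p q α / 2) * Real.cos α) - Real.cos α : ℝ) : ℂ) +
        ((-((‖b - w‖⁻¹ * Real.tanh (hNew p q α / 2) + 1) * Real.sin α) : ℝ) : ℂ) * Complex.I := by
      have hb' : b = (‖b‖ : ℂ) * hDir p q := mobiusAdd_neg_eq_smul hp hq hne
      have hw' : w = (Real.tanh (hNew p q α / 2) : ℂ) * rot α (hDir p q) := rfl
      have h6 : chordDir w b = (‖b - w‖⁻¹ : ℂ) * ((‖b‖ : ℂ) * hDir p q -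
          (Real.tanh (hNew p q α / 2) : ℂ) * rot α (hDir p q)) := by
        rw [← hb', ← hw', chordDir, Complex.real_smul, Complex.ofReal_inv]
      rw [h6, rot_eq]
      push_cast
      linear_combination ((‖b - w‖⁻¹ : ℂ) * ((‖b‖ : ℂ) - Complex.tanh (hNew p q α / 2) *
        (Complex.cos α + Complex.sin α * Complex.I)) -
          (Complex.cos α + Complex.sin α * Complex.I)) * hDD
    have h6 := Complex.abs_im_le_norm (conj (hDir p q) * (chordDir w b - rot α (hDir p q)))
    rw [norm_mul, Complex.norm_conj, hD, one_mul, h5] at h6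
    simp only [Complex.add_im, Complex.ofReal_im, Complex.im_ofReal_mul, Complex.I_im, mul_one,
      zero_add] at h6
    refine le_trans ?_ h6
    have h7 : 0 ≤ ‖b - w‖⁻¹ * Real.tanh (hNew p q α / 2) :=
      mul_nonneg (inv_nonneg.2 (norm_nonneg _)) hτ.le
    rw [abs_neg, abs_mul, abs_of_nonneg (by linarith : 0 ≤ ‖b - w‖⁻¹ *
      Real.tanh (hNew p q α / 2) + 1)]
    exact le_mul_of_one_le_left (abs_nonneg _) (by linarith)
  have h5 := norm_sub_le_norm_sub_add_norm_sub (chordDir w b) (hDir w b) (rot α (hDir p q))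
  linarith

theorem hNew_le (h : hDist p q ≤ 1 / 20) :
    hNew p q α ≤ hDist p q / 2 * (1 + 3 * (hDist p q + |Real.sin α|)) := by
  obtain ⟨h1, h2⟩ := ratio_mem_Ioo hp hq hne hgood hα
  have h3 := artanh_le_div h1.le h2
  have h4 := two_mul_norm_mobiusAdd_le_hDist hp hq
  have h5 := inv_cos_le hα
  have h6 := inv_cos_le_three_halves hα
  have h7 := norm_mobiusAdd_neg_pos hp hq hne
  have h8 := abs_nonneg (Real.sin α)
  have h9 := two_thirds_le_cos hα
  rw [hNew]
  refine h3.trans ?_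
  rw [tanh_half_hDist hp hq] at h1 h2 ⊢
  set e := hDist p q
  set t := ‖mobiusAdd (-p) q‖
  have he : 0 < e := by linarith
  have hy1 : t / Real.cos α ≤ e / 2 * (1 + 3 / 2 * |Real.sin α|) := by
    rw [div_eq_mul_inv]
    gcongr
    linarith
  have hy2 : t / Real.cos α ≤ e := by
    rw [div_eq_mul_inv]
    calc _ ≤ e / 2 * (3 / 2) := by gcongr; linarith
      _ ≤ e := by linarith
  rw [div_le_iff₀ (by linarith)]
  refine hy1.trans ?_
  rw [mul_assoc]
  gcongr
  have : (1 + 3 * (e + |Real.sin α|)) * (1 - e) ≤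
      (1 + 3 * (e + |Real.sin α|)) * (1 - t / Real.cos α) := by gcongr
  refine le_trans ?_ this
  nlinarith

theorem tanh_half_hNew_le (h : hDist p q ≤ 1 / 20) :
    Real.tanh (hNew p q α / 2) ≤ 2 * hDist p q := by
  have h1 := hNew_le hp hq hne hgood hα h
  have h2 := tanh_half_hNew_pos hp hq hne hgood hα
  have h3 := le_artanh h2.le (Real.tanh_lt_one _)
  rw [Real.artanh_tanh] at h3
  have h4 := Real.abs_sin_le_one α
  have h5 : 0 ≤ hDist p q := (norm_nonneg _).trans (norm_sub_le_hDist hp hq)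
  nlinarith

theorem hDist_hInsert_hInsert_le {β : ℝ} (hβ : β ∈ admissibleAngles) (h : hDist p q ≤ 1 / 20) :
    hDist (hInsert p q α) (hInsert p q β) ≤
      100 * hDist p q * (hDist p q + |Real.sin α| + |Real.sin β|) := by
  have hw := norm_hOffset_lt_one hp hq hne α
  have hw' := norm_hOffset_lt_one hp hq hne β
  have he : 0 ≤ hDist p q := (norm_nonneg _).trans (norm_sub_le_hDist hp hq)
  have h1 := tanh_half_hNew_mul_cos hp hq hne hgood hα
  have h1' := tanh_half_hNew_mul_cos hp hq hne hgood hβ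
  have h2 := tanh_half_hNew_le hp hq hne hgood hα h
  have h2' := tanh_half_hNew_le hp hq hne hgood hβ h
  have h3 := tanh_half_hNew_pos hp hq hne hgood hα
  have h3' := tanh_half_hNew_pos hp hq hne hgood hβ
  have h4 := norm_hOffset hp hq hne hgood hα
  have h4' := norm_hOffset hp hq hne hgood hβ
  have ht := two_mul_norm_mobiusAdd_le_hDist hp hq
  have ht0 := norm_nonneg (mobiusAdd (-p) q)
  have hD := norm_hDir hp hq hne
  rw [hDist, hInsert, hInsert, mobiusAdd_neg_mobiusAdd hp hw hw', norm_mul, norm_gyration hp hw,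
    one_mul]
  have h5 : ‖mobiusAdd (-hOffset p q α) (hOffset p q β)‖ ≤
      2 * ‖hOffset p q β - hOffset p q α‖ := by
    have h6 : 1 / 2 ≤ ‖1 - conj (hOffset p q α) * hOffset p q β‖ := by
      have h7 := norm_sub_norm_le 1 (conj (hOffset p q α) * hOffset p q β)
      rw [norm_one, norm_mul, Complex.norm_conj, h4, h4'] at h7
      nlinarith
    rw [mobiusAdd_neg, norm_div, div_le_iff₀ (by linarith)]
    nlinarith [norm_nonneg (hOffset p q β - hOffset p q α)]
  have h6 : ‖hOffset p q β - hOffset p q α‖ ≤ 1 / 5 := by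
    refine (norm_sub_le _ _).trans ?_
    rw [h4, h4']
    linarith
  have h7 := artanh_le_two_mul (norm_nonneg (mobiusAdd (-hOffset p q α) (hOffset p q β)))
    (by linarith)
  have h8 : ‖hOffset p q β - hOffset p q α‖ ≤ hDist p q ^ 2 +
      2 * hDist p q * (|Real.sin α| + |Real.sin β|) := by
    set τ := Real.tanh (hNew p q α / 2) with hτ
    set σ := Real.tanh (hNew p q β / 2) with hσ
    have e1 : hOffset p q β - hOffset p q α = (((σ * Real.cos β - τ * Real.cos α : ℝ) : ℂ) +
        ((σ * Real.sin β - τ * Real.sin α : ℝ) : ℂ) * Complex.I) * hDir p q := by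
      rw [hOffset, hOffset, rot_eq, rot_eq, ← hτ, ← hσ]
      push_cast
      ring
    rw [e1, norm_mul, hD, mul_one]
    refine (norm_add_le _ _).trans ?_
    rw [norm_mul, Complex.norm_I, mul_one, Complex.norm_real, Complex.norm_real, Real.norm_eq_abs,
      Real.norm_eq_abs]
    have e2 : σ * Real.cos β - τ * Real.cos α = (σ ^ 2 - τ ^ 2) * (‖mobiusAdd (-p) q‖ / 2) := by
      linear_combination (h1' - h1) / 2
    have e3 : |σ * Real.cos β - τ * Real.cos α| ≤ hDist p q ^ 2 := by
      have e4 : |σ ^ 2 - τ ^ 2| ≤ 4 * hDist p q ^ 2 := by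
        rw [abs_le]; constructor <;> nlinarith
      rw [e2, abs_mul, abs_of_nonneg (by positivity : 0 ≤ ‖mobiusAdd (-p) q‖ / 2)]
      have e8 := mul_le_mul e4 (by linarith : ‖mobiusAdd (-p) q‖ / 2 ≤ 1 / 4) (by positivity)
        (by positivity)
      linarith
    have e5 := abs_sub (σ * Real.sin β) (τ * Real.sin α)
    rw [abs_mul, abs_mul, abs_of_pos h3, abs_of_pos h3'] at e5
    have e6 := mul_le_mul_of_nonneg_right h2 (abs_nonneg (Real.sin α))
    have e7 := mul_le_mul_of_nonneg_right h2' (abs_nonneg (Real.sin β))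
    linarith
  nlinarith [mul_nonneg he (abs_nonneg (Real.sin α)), mul_nonneg he (abs_nonneg (Real.sin β)),
    mul_nonneg he he]

end HyperbolicInsert

theorem hasLocalEstimates_hyperbolicPlane : HasLocalEstimates hyperbolicPlane 100 (1 / 20) where
  B_nonneg := by norm_num
  η_pos := by norm_num
  gdist_self := fun (p : ℂ) _ => by
    change 2 * Real.artanh ‖mobiusAdd (-p) p‖ = 0
    simp [mobiusAdd]
  gdist_pos := fun (p : ℂ) hp (q : ℂ) hq h => by
    have hp : ‖p‖ < 1 := mem_ball_zero_iff.1 hp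
    have hq : ‖q‖ < 1 := mem_ball_zero_iff.1 hq
    have h1 := norm_mobiusAdd_neg_pos hp hq h.1
    exact (mul_pos two_pos h1).trans_le (two_mul_norm_mobiusAdd_le_hDist hp hq)
  ne_of_goodEdge := fun _ _ h => h.1
  insertPt_mem := fun _ hp _ hq h α _ => mem_ball_zero_iff.2
    (norm_hInsert_lt_one (mem_ball_zero_iff.1 hp) (mem_ball_zero_iff.1 hq) h.1 α)
  gdist_left_le := fun (p : ℂ) hp (q : ℂ) hq h α hα he => by
    have hp : ‖p‖ < 1 := mem_ball_zero_iff.1 hp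
    have hq : ‖q‖ < 1 := mem_ball_zero_iff.1 hq
    have h1 := hNew_le hp hq h.1 h.2 hα he
    change hDist p (hInsert p q α) ≤ hDist p q / 2 * (1 + 100 * (hDist p q + |Real.sin α|))
    rw [hDist_left_hInsert hp hq h.1 h.2 hα]
    have h2 : 0 ≤ hDist p q := (norm_nonneg _).trans (norm_sub_le_hDist hp hq)
    refine h1.trans ?_
    gcongr
    norm_num
  gdist_right_le := fun (p : ℂ) hp (q : ℂ) hq h α hα he => by
    have hp : ‖p‖ < 1 := mem_ball_zero_iff.1 hp
    have hq : ‖q‖ < 1 := mem_ball_zero_iff.1 hq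
    have h1 := hNew_le hp hq h.1 h.2 hα he
    change hDist (hInsert p q α) q ≤ hDist p q / 2 * (1 + 100 * (hDist p q + |Real.sin α|))
    rw [hDist_hInsert_right hp hq h.1 h.2 hα]
    have h2 : 0 ≤ hDist p q := (norm_nonneg _).trans (norm_sub_le_hDist hp hq)
    refine h1.trans ?_
    gcongr
    norm_num
  abs_sin_le := fun (p : ℂ) hp (q : ℂ) hq h α hα => by
    have hp : ‖p‖ < 1 := mem_ball_zero_iff.1 hp
    have hq : ‖q‖ < 1 := mem_ball_zero_iff.1 hq
    have h1 := abs_sin_le_hyperbolic hp hq h.1 h.2 hα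
    have h2 : 0 ≤ hDist p q := (norm_nonneg _).trans (norm_sub_le_hDist hp hq)
    exact h1.trans (le_mul_of_one_le_left (add_nonneg (abs_nonneg _) h2) (by norm_num))
  gdist_insertPt_le := fun _ hp _ hq h _ hα _ hβ he =>
    hDist_hInsert_hInsert_le (mem_ball_zero_iff.1 hp) (mem_ball_zero_iff.1 hq) h.1 h.2 hα hβ he
  exists_closed := fun N P C hN hper heven hP hC => by
    obtain ⟨m, hm, hmP⟩ := exists_hyperbolic_margin hN hper heven
      (fun k j => mem_ball_zero_iff.1 (hP k j)) hC
    have hlt : ∀ z : ℂ, m ≤ 1 - ‖z‖ ^ 2 → ‖z‖ < 1 := fun z hz => by nlinarith [norm_nonneg z]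
    refine ⟨{z : ℂ | m ≤ 1 - ‖z‖ ^ 2}, 1 + 2 / m, by positivity,
      isClosed_le continuous_const (by fun_prop), fun z hz => mem_ball_zero_iff.2 (hlt z hz), hmP,
      fun a ha p hp b hb hap hpb => ?_⟩
    exact hyperbolic_chord_estimates hm (hlt a ha) hp (hlt b hb) hap.1 hpb.1

theorem Geometry.exists_hasLocalEstimates (G : Geometry) : ∃ B η, HasLocalEstimates G.model B η := by
  cases G
  · exact ⟨_, _, hasLocalEstimates_euclideanPlane⟩
  · exact ⟨_, _, hasLocalEstimates_sphere⟩
  · exact ⟨_, _, hasLocalEstimates_hyperbolicPlane⟩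

theorem Geometry.completeSpace (G : Geometry) : CompleteSpace G.model.V := by
  cases G
  · exact inferInstanceAs (CompleteSpace ℂ)
  · exact inferInstanceAs (CompleteSpace R3)
  · exact inferInstanceAs (CompleteSpace ℂ)

end AngleSubdivision

end

open AngleSubdivision in
theorem corollary1 (G : Geometry) (s : ℝ) (hs : s = 1 ∨ s = -1) (K : ℝ) :
    ∃ C η : ℝ, 0 < η ∧
      ∀ (f : (Fin 7 → ℝ) → ℝ) (_ : ∀ x, f x ∈ admissibleAngles)
        (N : ℕ) (P : ℤ → G.model.V) (_ : IsClosedPolygon G.model N P)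
        (_ : ∀ k j, G.model.goodEdge (neuralIter G.model s f N P k j)
          (neuralIter G.model s f N P k (j + 1)))
        (_ : AngleDecay G.model K N (neuralIter G.model s f N P)),
        (∀ k, meshWidth G.model (N * 2 ^ k) (neuralIter G.model s f N P k) ≤ η → ∀ j,
          G.model.gdist
              (neuralStep G.model s f (N * 2 ^ k) (neuralIter G.model s f N P k) j)
              (fourPointStep G.model s (neuralIter G.model s f N P k) j)
            ≤ C * meshWidth G.model (N * 2 ^ k) (neuralIter G.model s f N P k) ^ 2) ∧
        (∃ C' : ℝ, ∀ k j,
          G.model.gdist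
              (neuralStep G.model s f (N * 2 ^ k) (neuralIter G.model s f N P k) j)
              (fourPointStep G.model s (neuralIter G.model s f N P k) j)
            ≤ C' * meshWidth G.model (N * 2 ^ k) (neuralIter G.model s f N P k) ^ 2) ∧
        HasC1LimitCurve G.model N (neuralIter G.model s f N P) := by
  obtain ⟨B, η, hM⟩ := G.exists_hasLocalEstimates
  have := G.completeSpace
  refine ⟨B * (1 + B * (Real.pi * K * (1 + B * (η + 1)) + 1) + Real.pi * K), η, hM.η_pos,
    fun f hf N P hP hgood hdecay => ?_⟩
  have H : IsAdmissible G.model s f N P K := ⟨hs, hf, hP, hgood, hdecay⟩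
  exact ⟨fun k hk j => H.proximity hM hk j, H.exists_proximity hM, H.hasC1LimitCurve hM⟩
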